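/- Let $n\ge 3$ and $p\in\mathbb R\setminus\{1\}$. Let $\mathcal P_o^n$ be the set of convex polytopes in $\mathbb R^n$ that contain the origin $o$, and let $\mathcal M^d(S^{n-1})$ be the set of finite positive Borel measures on the Euclidean unit sphere $S^{n-1}$ that are discrete, i.e. concentrated on a countable set. For a map $\mu:\mathcal P_o^n\to\mathcal M^d(S^{n-1})$, $P\mapsto\mu(P,\cdot)$, the following are equivalent. (a) $\mu$ is an $\mathrm{SL}(n)$ contravariant valuation of degree $p$, that is, $$\mu(P\cup Q,\cdot)+\mu(P\cap Q,\cdot)=\mu(P,\cdot)+\mu(Q,\cdot)$$ whenever $P,Q,P\cup Q,P\cap Q\in\mathcal P_o^n$, and $$\int_{S^{n-1}}f\,d\mu(\phi P,\cdot)=|\det\phi|\int_{S^{n-1}}f\circ\phi^{-t}\,d\mu(P,\cdot)$$ for every $\phi\in\mathrm{SL}(n)$ (so $|\det\phi|=1$), every $P\in\mathcal P_o^n$ and every continuous function $f:\mathbb R^n\setminus\{o\}\to\mathbb R$ with $f(tx)=t^pf(x)$ for all $t>0$ and $x\ne o$, where $\phi^{-t}$ is the transpose of the inverse of $\phi$.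 (b) There exist nonnegative constants $c_1,c_2\in\mathbb R$ such that $$\mu(P,\cdot)=c_1S_p(P,\cdot)+c_2S_p(-P,\cdot)\qquad\text{for every }P\in\mathcal P_o^n.$$ Here $S_p(P,\cdot)$ is the $L_p$ surface area measure $$S_p(P,\cdot)=\sum_{u\in\mathcal N^*(P)}h(P,u)^{1-p}\,V_{n-1}(F_u)\,\delta_u ,$$ where $h(P,u)=\max\{u\cdot y: y\in P\}$ is the support function, $F_u=\{y\in P: u\cdot y=h(P,u)\}$, $\mathcal N^*(P)$ is the set of unit vectors $u$ for which $F_u$ is a facet (an $(n-1)$-dimensional face) not containing $o$, $V_{n-1}$ is $(n-1)$-dimensional volume, and $\delta_u$ is the Dirac measure at $u$. -/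

import Mathlib

open MeasureTheory
open scoped NNReal ENNReal Matrix

noncomputable section

namespace LpSurface

/-- Euclidean `n`-space. -/
abbrev E (n : ℕ) : Type := EuclideanSpace ℝ (Fin n)

/-- The unit sphere of `ℝⁿ`, with its Borel σ-algebra. -/
abbrev Sph (n : ℕ) : Type := Metric.sphere (0 : E n) 1

/-- A convex polytope containing the origin: the convex hull of finitely many points. -/
structure PolytopeO (n : ℕ) where
  carrier : Set (E n)
  isPolytope : ∃ V : Finset (E n), carrier = convexHull ℝ (V : Set (E n))
  zero_mem : (0 : E n) ∈ carrier

/-- The linear image of a polytope containing the origin. -/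
def PolytopeO.map {n : ℕ} (P : PolytopeO n) (L : E n →ₗ[ℝ] E n) : PolytopeO n where
  carrier := L '' P.carrier
  isPolytope := by
    classical
    obtain ⟨V, hV⟩ := P.isPolytope
    exact ⟨V.image L, by rw [hV, L.image_convexHull, Finset.coe_image]⟩
  zero_mem := ⟨0, P.zero_mem, L.map_zero⟩

/-- The image `φ P` of `P` under an invertible matrix `φ`. -/
def PolytopeO.act {n : ℕ} (φ : GL (Fin n) ℝ) (P : PolytopeO n) : PolytopeO n :=
  P.map (Matrix.toEuclideanLin (φ : Matrix (Fin n) (Fin n) ℝ))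

/-- The reflected polytope `-P = {-x : x ∈ P}`. -/
instance (n : ℕ) : Neg (PolytopeO n) := ⟨fun P => P.map (-LinearMap.id)⟩

/-- The linear map given by `φ⁻ᵗ`, the transpose of the inverse of `φ`. -/
def invTranspose {n : ℕ} (φ : GL (Fin n) ℝ) : E n →ₗ[ℝ] E n :=
  Matrix.toEuclideanLin ((φ⁻¹ : GL (Fin n) ℝ) : Matrix (Fin n) (Fin n) ℝ)ᵀ

/-- Valuations on polytopes containing the origin, with values in finite Borel measures. -/
def IsValuation {n : ℕ} (μ : PolytopeO n → FiniteMeasure (Sph n)) : Prop :=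
  ∀ P Q U I : PolytopeO n,
    U.carrier = P.carrier ∪ Q.carrier → I.carrier = P.carrier ∩ Q.carrier →
      μ U + μ I = μ P + μ Q

/-- `f` is continuous on `ℝⁿ \ {o}` and (positively) homogeneous of degree `p` there;
its value at the origin is irrelevant. -/
structure IsContHomogeneous {n : ℕ} (p : ℝ) (f : E n → ℝ) : Prop where
  continuousOn : ContinuousOn f {0}ᶜ
  homogeneous : ∀ t : ℝ, 0 < t → ∀ x : E n, x ≠ 0 → f (t • x) = t ^ p * f x

/-- `G` contravariance of degree `p`, for a subgroup `G` of `GL(n)`. -/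
def IsContravariant {n : ℕ} (G : Subgroup (GL (Fin n) ℝ)) (p : ℝ)
    (μ : PolytopeO n → FiniteMeasure (Sph n)) : Prop :=
  ∀ φ ∈ G, ∀ P : PolytopeO n, ∀ f : E n → ℝ, IsContHomogeneous p f →
    ∫ u : Sph n, f u ∂(μ (P.act φ) : Measure (Sph n)) =
      |(φ : Matrix (Fin n) (Fin n) ℝ).det| *
        ∫ u : Sph n, f (invTranspose φ u) ∂(μ P : Measure (Sph n))

/-- `SL(n)` as a subgroup of `GL(n)`. -/
def SLn (n : ℕ) : Subgroup (GL (Fin n) ℝ) :=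
  (Matrix.SpecialLinearGroup.toGL (n := Fin n) (R := ℝ)).range

/-- A measure on the sphere is discrete if it is concentrated on a countable set. -/
def IsDiscrete {n : ℕ} (ν : FiniteMeasure (Sph n)) : Prop :=
  ∃ N : Set (Sph n), N.Countable ∧ (ν : Measure (Sph n)) Nᶜ = 0

/-- The support function `h(K, x) = max {x · y : y ∈ K}`. -/
def supportFn {n : ℕ} (K : Set (E n)) (x : E n) : ℝ :=
  sSup ((fun y => inner ℝ x y) '' K)

/-- The face `F_u` of `K` with outer normal vector `u`. -/
def face {n : ℕ} (K : Set (E n)) (u : E n) : Set (E n) :=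
  {y ∈ K | inner ℝ u y = supportFn K u}

/-- The unit normals of the facets (faces of dimension `n - 1`) of `P` that do not contain
the origin. -/
def facetNormalsStar {n : ℕ} (P : PolytopeO n) : Set (Sph n) :=
  {u | Module.finrank ℝ (vectorSpan ℝ (face P.carrier u)) + 1 = n ∧
    (0 : E n) ∉ face P.carrier u}

/-- The `L_p` surface area measure
`S_p(P, ·) = ∑ h(P, u) ^ (1 - p) V_{n-1}(F_u) δ_u`, summed over the unit normals `u` of the facets
of `P` not containing the origin. The volume `V_{n-1}` is `(n-1)`-dimensional Hausdorff measure,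
normalized to agree with Lebesgue measure on `ℝ^(n-1)`. -/
def lpSurfaceArea {n : ℕ} (p : ℝ) (P : PolytopeO n) : Measure (Sph n) :=
  Measure.sum fun u : facetNormalsStar P =>
    (ENNReal.ofReal (supportFn P.carrier (u : Sph n) ^ (1 - p)) *
      μHE[n - 1] (face P.carrier (u : Sph n))) • Measure.dirac (u : Sph n)

end LpSurface

end

noncomputable section

namespace LpSurface

section

/-! ### Polyhedral cones and polytopes -/

section Cone
variable {M : Type*} [AddCommGroup M] [Module ℝ M]

/-! Everything is read off from atoms. For x ≠ 0 put w(P, x) = ‖x‖^(-p) μ(P, {x/‖x‖}). Since the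
measures are discrete, (a) says exactly that w satisfies `IsMassFunction`: it is nonnegative, a
valuation in P, homogeneous of degree -p in x, has w(φP, x) = w(P, φᵗx) for det φ = 1, and charges
only countably many directions (`isMassFunction_atomMass_iff`). The measure S_p has mass function
`surfaceMass`, so (b) says that w is a conic combination of `surfaceMass` and its reflection
(`eq_lpSurfaceArea_iff`).

`surfaceMass` is a mass function: its valuation property is inclusion-exclusion on faces, and its
equivariance compares volumes of cylinders over faces. Hence (b) implies (a).

The converse is the uniqueness theorem `IsMassFunction.eq_of_box_eq`: w is determined by its values
at ±e₀ on the pyramid with apex o over a unit cube in {y₀ = 1}. It rests on three facts.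

Polytopes in a hyperplane b^⊥ have no mass (`eq_zero_of_inner_eq_zero`). Shears fixing b^⊥ pointwise
carry x along x + sb, so mass in a direction not parallel to b would give uncountably many atoms.
For x parallel to b, halving a flat box multiplies its mass by 2^(1-p) after normalization, which
forces zero because p ≠ 1; this needs a third coordinate, hence n ≥ 3. Consequently w is additive
under cuts by hyperplanes through o, hence determined by pyramids {⟨ℓ, y⟩ ≤ 1} ∩ cone
(`eq_zero_of_pyramid`) and monotone in a suitable sense (`le_of_isPyramid`).

A pyramid has no mass in directions other than ±ℓ (`eq_zero_of_isPyramid`), again by countability: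
it lies inside a sheared box pyramid for which the given direction is not an atom.

In the directions ±ℓ, a map of determinant one moves ℓ to e₀. There w is invariant under
translations of {y₀ = 1} and additive, and a monotone, translation-invariant additive function of
the base is a multiple of its volume (`IsInvariant.eq_mul_baseVol`). -/

/-- A finitely generated cone is a finite intersection of half-spaces. -/
theorem exists_finset_mem_span_iff [FiniteDimensional ℝ M] (V : Finset M) :
    ∃ S : Finset (Module.Dual ℝ M), ∀ x, x ∈ Submodule.span ℝ≥0 (V : Set M) ↔ ∀ s ∈ S, 0 ≤ s x := by
  classical
  induction V using Finset.induction_on with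
  | empty =>
    let b := Module.finBasis ℝ M
    refine ⟨Finset.univ.image b.coord ∪ Finset.univ.image (fun i => -b.coord i), fun x => ?_⟩
    simp only [Finset.coe_empty, Submodule.span_empty, Submodule.mem_bot, Finset.mem_union,
      Finset.mem_image, Finset.mem_univ, true_and]
    constructor
    · rintro rfl s _
      simp
    · intro h
      refine b.ext_elem fun i => ?_
      have h1 := h _ (Or.inl ⟨i, rfl⟩)
      have h2 := h _ (Or.inr ⟨i, rfl⟩)
      simp only [Module.Basis.coord_apply, LinearMap.neg_apply] at h1 h2
      simp only [map_zero, Finsupp.coe_zero, Pi.zero_apply]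
      linarith
  | insert v V _ ih =>
    obtain ⟨S, hS⟩ := ih
    -- Fourier-Motzkin elimination of a in `x - a • v`: each s with s v < 0 bounds a from below,
    -- each with s v > 0 from above, and the mixed combinations, which vanish at v, say that no
    -- lower bound exceeds an upper one.
    refine ⟨S.filter (fun s => 0 ≤ s v) ∪
      Finset.image₂ (fun s t : Module.Dual ℝ M => s v • t - t v • s)
        (S.filter (fun s => 0 < s v)) (S.filter (fun s => s v < 0)), fun x => ?_⟩
    rw [Finset.coe_insert, Submodule.mem_span_insert]
    constructor
    · rintro ⟨a, z, hz, rfl⟩ s hs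
      rw [hS] at hz
      rw [Finset.mem_union, Finset.mem_filter, Finset.mem_image₂] at hs
      rcases hs with ⟨hs, hv⟩ | ⟨s, hs, t, ht, rfl⟩
      · have := hz s hs
        rw [map_add, NNReal.smul_def, map_smul, smul_eq_mul]
        have := mul_nonneg a.2 hv
        simp only [NNReal.val_eq_coe] at this
        linarith
      · rw [Finset.mem_filter] at hs ht
        have h1 := mul_nonneg hs.2.le (hz t ht.1)
        have h2 := mul_nonneg (neg_nonneg.2 ht.2.le) (hz s hs.1)
        simp only [NNReal.smul_def, LinearMap.sub_apply, LinearMap.smul_apply, map_add, map_smul,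
          smul_eq_mul]
        nlinarith
    · intro h
      have h1 : ∀ s ∈ S, 0 ≤ s v → 0 ≤ s x := fun s hs hv =>
        h s (Finset.mem_union_left _ (Finset.mem_filter.2 ⟨hs, hv⟩))
      have h2 : ∀ s ∈ S, ∀ t ∈ S, 0 < s v → t v < 0 → 0 ≤ s v * t x - t v * s x := by
        intro s hs t ht hsv htv
        simpa using h _ (Finset.mem_union_right _ (Finset.mem_image₂.2
          ⟨s, Finset.mem_filter.2 ⟨hs, hsv⟩, t, Finset.mem_filter.2 ⟨ht, htv⟩, rfl⟩))
      -- The lower bounds for a, including a ≥ 0; the largest one is the witness.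
      let B : Finset ℝ := insert 0 ((S.filter (fun s => s v < 0)).image (fun t => t x / t v))
      have hB : B.Nonempty := Finset.insert_nonempty _ _
      have hmax : ∀ b ∈ B, b ≤ B.max' hB := fun b hb => Finset.le_max' _ _ hb
      have h0 : 0 ≤ B.max' hB := hmax 0 (Finset.mem_insert_self _ _)
      refine ⟨⟨B.max' hB, h0⟩, x - B.max' hB • v, ?_, ?_⟩
      · rw [hS]
        intro s hs
        rw [map_sub, map_smul, smul_eq_mul]
        rcases lt_or_ge (s v) 0 with hv | hv
        · have := hmax (s x / s v) (Finset.mem_insert_of_mem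
            (Finset.mem_image_of_mem _ (Finset.mem_filter.2 ⟨hs, hv⟩)))
          rw [div_le_iff_of_neg hv] at this
          linarith
        · have hm := Finset.max'_mem B hB
          rw [Finset.mem_insert, Finset.mem_image] at hm
          rcases hm with hm | ⟨t, ht, hm⟩
          · rw [hm]
            have := h1 s hs hv
            linarith
          · rw [Finset.mem_filter] at ht
            rw [← hm]
            rcases hv.eq_or_lt with hv | hv
            · rw [← hv]
              have := h1 s hs hv.le
              linarith
            · have h3 := h2 s hs t ht.1 hv ht.2
              have h4 : t x / t v * s v ≤ s x := by
                rw [div_mul_eq_mul_div, div_le_iff_of_neg ht.2]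
                linarith
              linarith
      · exact (add_sub_cancel (B.max' hB • v) x).symm

/-- A finite intersection of linear half-spaces is a finitely generated cone. -/
theorem exists_finset_span_eq [FiniteDimensional ℝ M] (S : Finset (Module.Dual ℝ M)) :
    ∃ T : Finset M, ∀ x, x ∈ Submodule.span ℝ≥0 (T : Set M) ↔ ∀ s ∈ S, 0 ≤ s x := by
  classical
  obtain ⟨T, hT⟩ := exists_finset_mem_span_iff S
  let e := Module.evalEquiv ℝ M
  have he : ∀ (t : Module.Dual ℝ (Module.Dual ℝ M)) (s : Module.Dual ℝ M), t s = s (e.symm t) := by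
    intro t s
    conv_lhs => rw [← e.apply_symm_apply t]
    rfl
  refine ⟨T.image e.symm, fun x => ?_⟩
  -- Bipolar argument: a functional in S' is nonnegative on the generators, so by the choice of T it
  -- lies in the cone generated by S, and is therefore nonnegative at x.
  obtain ⟨S', hS'⟩ := exists_finset_mem_span_iff (T.image e.symm)
  constructor
  · intro hx s hs
    have hs' := (hT s).1 (Submodule.subset_span hs)
    induction hx using Submodule.span_induction with
    | mem y hy =>
      obtain ⟨t, ht, rfl⟩ := Finset.mem_image.1 (Finset.mem_coe.1 hy)
      rw [← he]
      exact hs' t ht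
    | zero => simp
    | add y z _ _ hy hz => rw [map_add]; exact add_nonneg hy hz
    | smul a y _ hy =>
      rw [NNReal.smul_def, map_smul, smul_eq_mul]
      exact mul_nonneg a.2 hy
  · intro hx
    rw [hS']
    intro s hs
    have hs' : s ∈ Submodule.span ℝ≥0 (S : Set (Module.Dual ℝ M)) := by
      rw [hT]
      intro t ht
      rw [he]
      exact (hS' _).1 (Submodule.subset_span (Finset.mem_coe.2 (Finset.mem_image_of_mem _ ht))) s hs
    clear hs
    induction hs' using Submodule.span_induction with
    | mem y hy => exact hx y hy
    | zero => simp
    | add y z _ _ hy hz => exact add_nonneg hy hz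
    | smul a y _ hy =>
      rw [NNReal.smul_def, LinearMap.smul_apply, smul_eq_mul]
      exact mul_nonneg a.2 hy

end Cone

/-! ### Polytopes as bounded polyhedra -/

variable {n : ℕ}

@[ext]
theorem PolytopeO.ext {P Q : PolytopeO n} (h : P.carrier = Q.carrier) : P = Q := by
  cases P; cases Q; simp_all

theorem PolytopeO.isCompact (P : PolytopeO n) : IsCompact P.carrier := by
  obtain ⟨V, hV⟩ := P.isPolytope
  rw [hV]
  exact V.finite_toSet.isCompact_convexHull ℝ

theorem PolytopeO.convex (P : PolytopeO n) : Convex ℝ P.carrier := by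
  obtain ⟨V, hV⟩ := P.isPolytope
  rw [hV]
  exact convex_convexHull ℝ _

/-- The polyhedron given by the inequalities `⟪c.1, x⟫ ≤ c.2`, `c ∈ A`. -/
def polyhedron (A : Set (E n × ℝ)) : Set (E n) := {x | ∀ c ∈ A, inner ℝ c.1 x ≤ c.2}

theorem convex_polyhedron (A : Set (E n × ℝ)) : Convex ℝ (polyhedron A) := by
  intro x hx y hy a b ha hb hab c hc
  rw [inner_add_right, inner_smul_right, inner_smul_right]
  have h1 := mul_le_mul_of_nonneg_left (hx c hc) ha
  have h2 := mul_le_mul_of_nonneg_left (hy c hc) hb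
  have h3 : a * c.2 + b * c.2 = c.2 := by rw [← add_mul, hab, one_mul]
  linarith

theorem eq_zero_of_forall_smul_mem {K : Set (E n)} (hK : Bornology.IsBounded K) {y : E n}
    (h : ∀ t : ℝ, 0 ≤ t → t • y ∈ K) : y = 0 := by
  by_contra hy
  obtain ⟨R, hR⟩ := hK.exists_norm_le
  have hy' : 0 < ‖y‖ := norm_pos_iff.2 hy
  have hR0 : 0 ≤ R := (norm_nonneg _).trans (hR _ (h 0 le_rfl))
  have h1 := hR _ (h ((R + 1) / ‖y‖) (by positivity))
  rw [norm_smul, Real.norm_of_nonneg (by positivity), div_mul_cancel₀ _ hy'.ne'] at h1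
  linarith

/-- A bounded polyhedron containing the origin is a polytope. -/
theorem exists_polytope_eq_polyhedron (A : Finset (E n × ℝ))
    (hb : Bornology.IsBounded (polyhedron (A : Set (E n × ℝ)))) (h0 : ∀ c ∈ A, 0 ≤ c.2) :
    ∃ P : PolytopeO n, P.carrier = polyhedron (A : Set (E n × ℝ)) := by
  classical
  -- Homogenization: the polyhedron is the slice at height 1 of a cone in `E n × ℝ`. Generators of
  -- positive height give the vertices; those of height 0 are recession directions, hence zero by
  -- boundedness.
  let F : E n × ℝ → Module.Dual ℝ (E n × ℝ) := fun c =>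
    c.2 • LinearMap.snd ℝ (E n) ℝ - (innerₗ (E n) c.1) ∘ₗ LinearMap.fst ℝ (E n) ℝ
  have hF : ∀ c z, F c z = c.2 * z.2 - inner ℝ c.1 z.1 := fun c z => by simp [F]
  obtain ⟨T, hT⟩ := exists_finset_span_eq (insert (LinearMap.snd ℝ (E n) ℝ) (A.image F))
  have hT' : ∀ z : E n × ℝ, z ∈ Submodule.span ℝ≥0 (T : Set (E n × ℝ)) ↔
      0 ≤ z.2 ∧ ∀ c ∈ A, inner ℝ c.1 z.1 ≤ c.2 * z.2 := by
    intro z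
    rw [hT, Finset.forall_mem_insert, Finset.forall_mem_image]
    simp only [hF, LinearMap.snd_apply, sub_nonneg]
  have hpos : ∀ z ∈ T, 0 ≤ z.2 ∧ ∀ c ∈ A, inner ℝ c.1 z.1 ≤ c.2 * z.2 := fun z hz =>
    (hT' z).1 (Submodule.subset_span hz)
  have hzero : ∀ z ∈ T, ¬ 0 < z.2 → z = 0 := by
    intro z hz h
    have h2 : z.2 = 0 := le_antisymm (not_lt.1 h) (hpos z hz).1
    refine Prod.ext (eq_zero_of_forall_smul_mem hb fun t ht c hc => ?_) h2
    have := (hpos z hz).2 c hc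
    rw [h2, mul_zero] at this
    rw [inner_smul_right]
    exact (mul_nonpos_of_nonneg_of_nonpos ht this).trans (h0 c hc)
  let V : Finset (E n) := (T.filter fun z => 0 < z.2).image fun z => z.2⁻¹ • z.1
  refine ⟨⟨polyhedron A, ⟨V, Set.Subset.antisymm ?_ ?_⟩, fun c hc => by simpa using h0 c hc⟩, rfl⟩
  · intro x hx
    have hx' : (x, (1 : ℝ)) ∈ Submodule.span ℝ≥0 (T : Set (E n × ℝ)) := by
      rw [hT']
      exact ⟨zero_le_one, fun c hc => by simpa using hx c hc⟩
    obtain ⟨f, -, hf⟩ := Submodule.mem_span_finset.1 hx'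
    have hf' : ∑ z ∈ T.filter (fun z => 0 < z.2), f z • z = (x, (1 : ℝ)) := by
      rw [← hf]
      refine Finset.sum_subset (Finset.filter_subset _ _) fun z hz hz' => ?_
      rw [hzero z hz fun h => hz' (Finset.mem_filter.2 ⟨hz, h⟩), smul_zero]
    have h1 := congrArg Prod.fst hf'
    have h2 := congrArg Prod.snd hf'
    rw [Prod.fst_sum] at h1
    rw [Prod.snd_sum] at h2
    simp only [Prod.smul_fst, Prod.smul_snd, NNReal.smul_def, smul_eq_mul] at h1 h2
    have hx2 : x = ∑ z ∈ T.filter (fun z => 0 < z.2), ((f z : ℝ) * z.2) • (z.2⁻¹ • z.1) := by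
      rw [← h1]
      refine Finset.sum_congr rfl fun z hz => ?_
      rw [smul_smul, mul_assoc, mul_inv_cancel₀ (Finset.mem_filter.1 hz).2.ne', mul_one]
    rw [hx2]
    refine (convex_convexHull ℝ _).sum_mem (fun z hz => ?_) h2 fun z hz => ?_
    · exact mul_nonneg (f z).2 (Finset.mem_filter.1 hz).2.le
    · exact subset_convexHull ℝ _ (Finset.mem_coe.2 (Finset.mem_image_of_mem _ hz))
  · refine convexHull_min (fun x hx => ?_) (convex_polyhedron _)
    obtain ⟨z, hz, rfl⟩ := Finset.mem_image.1 (Finset.mem_coe.1 hx)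
    rw [Finset.mem_filter] at hz
    intro c hc
    have := (hpos z hz.1).2 c hc
    rw [inner_smul_right, inv_mul_le_iff₀ hz.2]
    linarith

/-- A polytope is a polyhedron. -/
theorem PolytopeO.exists_eq_polyhedron (P : PolytopeO n) :
    ∃ A : Finset (E n × ℝ), P.carrier = polyhedron (A : Set (E n × ℝ)) ∧ ∀ c ∈ A, 0 ≤ c.2 := by
  classical
  obtain ⟨V, hV⟩ := P.isPolytope
  obtain ⟨S, hS⟩ := exists_finset_mem_span_iff (V.image fun v => (v, (1 : ℝ)))
  let G : Module.Dual ℝ (E n × ℝ) → E n × ℝ := fun s =>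
    (-(InnerProductSpace.toDual ℝ (E n)).symm (LinearMap.toContinuousLinearMap
      (s ∘ₗ LinearMap.inl ℝ (E n) ℝ)), s (0, 1))
  have hG : ∀ s x, (inner ℝ (G s).1 x ≤ (G s).2 ↔ 0 ≤ s (x, 1)) := by
    intro s x
    have : s (x, 1) = s (x, 0) + s (0, 1) := by rw [← map_add]; simp
    simp only [G, inner_neg_left, InnerProductSpace.toDual_symm_apply]
    simp only [LinearMap.coe_toContinuousLinearMap', LinearMap.comp_apply, LinearMap.inl_apply]
    constructor <;> intro h <;> linarith
  have hP : P.carrier = polyhedron ((S.image G : Finset (E n × ℝ)) : Set (E n × ℝ)) := by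
    ext x
    have : x ∈ P.carrier ↔
        (x, (1 : ℝ)) ∈ Submodule.span ℝ≥0 ((V.image fun v => (v, (1 : ℝ)) : Finset _) :
          Set (E n × ℝ)) := by
      rw [hV]
      constructor
      · intro hx
        obtain ⟨w, hw0, hw1, hw⟩ := Finset.mem_convexHull'.1 hx
        have : (x, (1 : ℝ)) = ∑ y ∈ V, (w y).toNNReal • (y, (1 : ℝ)) := by
          refine Prod.ext ?_ ?_
          · rw [Prod.fst_sum, ← hw]
            exact Finset.sum_congr rfl fun y hy => by
              simp [NNReal.smul_def, Real.coe_toNNReal _ (hw0 y hy)]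
          · rw [Prod.snd_sum]
            refine hw1.symm.trans (Finset.sum_congr rfl fun y hy => ?_)
            simp [NNReal.smul_def, Real.coe_toNNReal _ (hw0 y hy)]
        rw [this]
        exact Submodule.sum_mem _ fun y hy => Submodule.smul_mem _ _
          (Submodule.subset_span (Finset.mem_coe.2 (Finset.mem_image_of_mem _ hy)))
      · intro hx
        obtain ⟨f, -, hf⟩ := Submodule.mem_span_finset.1 hx
        rw [Finset.sum_image (fun a _ b _ h => (Prod.ext_iff.1 h).1)] at hf
        have h1 := congrArg Prod.fst hf
        have h2 := congrArg Prod.snd hf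
        rw [Prod.fst_sum] at h1
        rw [Prod.snd_sum] at h2
        simp only [Prod.smul_fst, Prod.smul_snd, NNReal.smul_def, smul_eq_mul, mul_one] at h1 h2
        rw [← h1]
        exact (convex_convexHull ℝ _).sum_mem (fun v _ => (f _).2) h2
          fun v hv => subset_convexHull ℝ _ hv
    rw [this, hS]
    simp [polyhedron, hG]
  refine ⟨_, hP, fun c hc => ?_⟩
  have := P.zero_mem
  rw [hP] at this
  simpa using this c hc

/-- The half of a polytope cut off by a hyperplane through the origin. -/
theorem PolytopeO.exists_cut (P : PolytopeO n) (a : E n) :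
    ∃ Q : PolytopeO n, Q.carrier = P.carrier ∩ {y | inner ℝ a y ≤ 0} := by
  classical
  obtain ⟨A, hA, h0⟩ := P.exists_eq_polyhedron
  have : polyhedron ((insert (a, (0 : ℝ)) A : Finset (E n × ℝ)) : Set (E n × ℝ)) =
      P.carrier ∩ {y | inner ℝ a y ≤ 0} := by
    ext y
    simp [hA, polyhedron, and_comm]
  rw [← this]
  refine exists_polytope_eq_polyhedron _ ?_ ?_
  · rw [this]
    exact P.isCompact.isBounded.subset Set.inter_subset_left
  · intro c hc
    rcases Finset.mem_insert.1 hc with rfl | hc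
    · exact le_rfl
    · exact h0 c hc

/-- The part of a polytope in the half-space `{y | ⟪a, y⟫ ≤ 0}`. -/
def PolytopeO.cut (P : PolytopeO n) (a : E n) : PolytopeO n := (P.exists_cut a).choose

theorem PolytopeO.mem_cut {P : PolytopeO n} {a y : E n} :
    y ∈ (P.cut a).carrier ↔ y ∈ P.carrier ∧ inner ℝ a y ≤ 0 := by
  rw [PolytopeO.cut, (P.exists_cut a).choose_spec]
  rfl

theorem PolytopeO.cut_subset (P : PolytopeO n) (a : E n) : (P.cut a).carrier ⊆ P.carrier :=
  fun _ h => (PolytopeO.mem_cut.1 h).1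

theorem PolytopeO.mem_cut_cut_neg {P : PolytopeO n} {a y : E n} :
    y ∈ ((P.cut a).cut (-a)).carrier ↔ y ∈ P.carrier ∧ inner ℝ a y = 0 := by
  rw [PolytopeO.mem_cut, PolytopeO.mem_cut, inner_neg_left, and_assoc, le_antisymm_iff, neg_nonpos]

end

section

variable {n : ℕ}

/-! ### Linear maps of determinant one -/

theorem det_toEuclideanLin (M : Matrix (Fin n) (Fin n) ℝ) :
    LinearMap.det (Matrix.toEuclideanLin M) = M.det := by
  exact LinearMap.det_toLin (PiLp.basisFun 2 ℝ (Fin n)) M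

theorem adjoint_toEuclideanLin (M : Matrix (Fin n) (Fin n) ℝ) :
    LinearMap.adjoint (Matrix.toEuclideanLin M) = Matrix.toEuclideanLin Mᵀ := by
  rw [← Matrix.toEuclideanLin_conjTranspose_eq_adjoint, Matrix.conjTranspose_eq_transpose_of_trivial]

theorem det_adjoint (L : E n →ₗ[ℝ] E n) :
    LinearMap.det (LinearMap.adjoint L) = LinearMap.det L := by
  obtain ⟨M, rfl⟩ := Matrix.toEuclideanLin.surjective L
  rw [adjoint_toEuclideanLin, det_toEuclideanLin, det_toEuclideanLin, Matrix.det_transpose]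

/-- The standard unit vectors. -/
abbrev unitVec (i : Fin n) : E n := EuclideanSpace.single i (1 : ℝ)

theorem inner_unitVec (i : Fin n) (y : E n) : inner ℝ (unitVec i) y = y i := by
  simp [unitVec, EuclideanSpace.inner_single_left]

/-- The map `y ↦ y + ⟪b, y⟫ a`. -/
def shear (b a : E n) : E n →ₗ[ℝ] E n := LinearMap.transvection (innerₗ (E n) b) a

theorem shear_apply (b a y : E n) : shear b a y = y + (inner ℝ b y : ℝ) • a := rfl

theorem det_shear {b a : E n} (h : inner ℝ b a = 0) : LinearMap.det (shear b a) = 1 := by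
  have h' : innerₗ (E n) b a = 0 := h
  have := congrArg Units.val (LinearEquiv.transvection.det_eq_one h')
  rwa [LinearEquiv.coe_det, Units.val_one] at this

theorem adjoint_shear (b a x : E n) : LinearMap.adjoint (shear b a) x = shear a b x := by
  refine ext_inner_right ℝ fun y => ?_
  rw [LinearMap.adjoint_inner_left, shear_apply, shear_apply, inner_add_left, inner_add_right,
    inner_smul_left, inner_smul_right, real_inner_comm x a]
  simp only [conj_trivial]
  ring

/-- The diagonal linear map with entries `d`. -/
def diag (d : Fin n → ℝ) : E n →ₗ[ℝ] E n := Matrix.toEuclideanLin (Matrix.diagonal d)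

theorem diag_apply (d : Fin n → ℝ) (y : E n) (i : Fin n) : diag d y i = d i * y i := by
  simp [diag, Matrix.toLpLin_apply, Matrix.mulVec_diagonal]

theorem det_diag (d : Fin n → ℝ) : LinearMap.det (diag d) = ∏ i, d i := by
  rw [diag, det_toEuclideanLin, Matrix.det_diagonal]

theorem adjoint_diag (d : Fin n → ℝ) : LinearMap.adjoint (diag d) = diag d := by
  rw [diag, adjoint_toEuclideanLin, Matrix.diagonal_transpose]

theorem diag_unitVec (d : Fin n → ℝ) (i : Fin n) : diag d (unitVec i) = d i • unitVec i := by
  ext j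
  rw [diag_apply]
  by_cases h : j = i
  · subst h; simp
  · simp [h]

theorem zero_ne_two_fin {m : ℕ} : (0 : Fin (m + 3)) ≠ 2 := fun h => by
  have := congrArg Fin.val h
  rw [Fin.val_two] at this
  simp at this

theorem one_ne_two_fin {m : ℕ} : (1 : Fin (m + 3)) ≠ 2 := fun h => by
  have := congrArg Fin.val h
  rw [Fin.val_two, Fin.val_one] at this
  simp at this

theorem exists_linearIndependent_extend {u v : E n} (h : LinearIndependent ℝ ![u, v]) (j : ℕ)
    (hj : 2 + j ≤ n) : ∃ f : Fin (2 + j) → E n, LinearIndependent ℝ f ∧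
      f ⟨0, by omega⟩ = u ∧ f ⟨1, by omega⟩ = v := by
  induction j with
  | zero => exact ⟨_, h, rfl, rfl⟩
  | succ j ih =>
    obtain ⟨f, hf, h0, h1⟩ := ih (by omega)
    obtain ⟨x, hx⟩ := exists_linearIndependent_snoc_of_lt_finrank hf
      (by rw [finrank_euclideanSpace_fin]; omega)
    refine ⟨_, hx, ?_, ?_⟩
    · rw [← h0]
      exact Fin.snoc_castSucc (α := fun _ => E n) x f ⟨0, by omega⟩
    · rw [← h1]
      exact Fin.snoc_castSucc (α := fun _ => E n) x f ⟨1, by omega⟩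

/-- Extend u, v to a basis; the determinant of the change of basis is then corrected by rescaling
the third basis vector, for which dimension at least three is needed. -/
theorem exists_det_eq_one_map {m : ℕ} {u v : E (m + 3)} (h : LinearIndependent ℝ ![u, v]) :
    ∃ A : E (m + 3) →ₗ[ℝ] E (m + 3), LinearMap.det A = 1 ∧ A (unitVec 0) = u ∧
      A (unitVec 1) = v := by
  obtain ⟨f, hf, h0, h1⟩ : ∃ f : Fin (m + 3) → E (m + 3), LinearIndependent ℝ f ∧
      f 0 = u ∧ f 1 = v := by
    obtain ⟨f, hf, h0, h1⟩ := exists_linearIndependent_extend h (m + 1) (by omega)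
    have e : m + 3 = 2 + (m + 1) := by omega
    exact ⟨f ∘ finCongr e, hf.comp _ (finCongr e).injective, h0, h1⟩
  let b := (EuclideanSpace.basisFun (Fin (m + 3)) ℝ).toBasis
  let c := basisOfLinearIndependentOfCardEqFinrank hf (by simp)
  let A₀ : E (m + 3) ≃ₗ[ℝ] E (m + 3) := b.equiv c (Equiv.refl _)
  have hA₀ : ∀ i, A₀ (unitVec i) = f i := by
    intro i
    have h1 : A₀ (b i) = c i := b.equiv_apply i c (Equiv.refl _)
    simpa [b, c] using h1
  have hd : LinearMap.det (A₀ : E (m + 3) →ₗ[ℝ] E (m + 3)) ≠ 0 := A₀.isUnit_det'.ne_zero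
  let d : Fin (m + 3) → ℝ :=
    fun i => if i = 2 then (LinearMap.det (A₀ : E (m + 3) →ₗ[ℝ] E (m + 3)))⁻¹ else 1
  refine ⟨A₀ ∘ₗ diag d, ?_, ?_, ?_⟩
  · rw [LinearMap.det_comp, det_diag, Finset.prod_ite_eq' Finset.univ (2 : Fin (m + 3))]
    simp [hd]
  · have : d 0 = 1 := if_neg zero_ne_two_fin
    simp [diag_unitVec, this, hA₀, h0]
  · have : d 1 = 1 := if_neg one_ne_two_fin
    simp [diag_unitVec, this, hA₀, h1]

/-- Two linearly independent vectors are mapped to two unit vectors by some volume-preserving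
linear map, whose adjoint does the same. -/
theorem exists_det_eq_one_adjoint {m : ℕ} {u v : E (m + 3)} (h : LinearIndependent ℝ ![u, v]) :
    ∃ A : E (m + 3) ≃ₗ[ℝ] E (m + 3), LinearMap.det (A : E (m + 3) →ₗ[ℝ] E (m + 3)) = 1 ∧
      LinearMap.det (A.symm : E (m + 3) →ₗ[ℝ] E (m + 3)) = 1 ∧
      LinearMap.adjoint (A : E (m + 3) →ₗ[ℝ] E (m + 3)) (unitVec 0) = u ∧
      LinearMap.adjoint (A : E (m + 3) →ₗ[ℝ] E (m + 3)) (unitVec 1) = v ∧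
      LinearMap.adjoint (A.symm : E (m + 3) →ₗ[ℝ] E (m + 3)) u = unitVec 0 ∧
      LinearMap.adjoint (A.symm : E (m + 3) →ₗ[ℝ] E (m + 3)) v = unitVec 1 := by
  obtain ⟨B, hB, h0, h1⟩ := exists_det_eq_one_map h
  have hd : LinearMap.det (LinearMap.adjoint B) = 1 := by rw [det_adjoint, hB]
  let A := LinearEquiv.ofIsUnitDet (v := (EuclideanSpace.basisFun (Fin (m + 3)) ℝ).toBasis)
    (v' := (EuclideanSpace.basisFun (Fin (m + 3)) ℝ).toBasis) (f := LinearMap.adjoint B)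
    (by rw [LinearMap.det_toMatrix, hd]; exact isUnit_one)
  have hA : (A : E (m + 3) →ₗ[ℝ] E (m + 3)) = LinearMap.adjoint B := by ext x; rfl
  have hA' : LinearMap.adjoint (A : E (m + 3) →ₗ[ℝ] E (m + 3)) = B := by
    rw [hA, LinearMap.adjoint_adjoint]
  have hs : ∀ x, LinearMap.adjoint (A.symm : E (m + 3) →ₗ[ℝ] E (m + 3)) (B x) = x := by
    intro x
    refine ext_inner_right ℝ fun y => ?_
    rw [LinearMap.adjoint_inner_left, ← hA', LinearMap.adjoint_inner_left]
    simp
  refine ⟨A, by rw [hA, hd], ?_, by rw [hA', h0], by rw [hA', h1], by rw [← h0, hs],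
    by rw [← h1, hs]⟩
  have := LinearEquiv.det_symm_mul_det A
  rw [hA, hd, mul_one] at this
  exact this

theorem PolytopeO.mem_map_equiv {P : PolytopeO n} (A : E n ≃ₗ[ℝ] E n) {y : E n} :
    y ∈ (P.map (A : E n →ₗ[ℝ] E n)).carrier ↔ A.symm y ∈ P.carrier := by
  constructor
  · rintro ⟨x, hx, rfl⟩
    simpa using hx
  · intro h
    exact ⟨_, h, by simp⟩

end

section

variable {n : ℕ} {p : ℝ}

/-! ### Mass functions -/

/-- The properties of the function `w P x = ‖x‖ ^ (-p) * μ P {x / ‖x‖}` describing the atoms of an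
`SL(n)` contravariant valuation `μ` of degree `p`. -/
structure IsMassFunction (p : ℝ) (w : PolytopeO n → E n → ℝ) : Prop where
  nonneg : ∀ P x, 0 ≤ w P x
  valuation : ∀ (P Q U I : PolytopeO n), U.carrier = P.carrier ∪ Q.carrier →
    I.carrier = P.carrier ∩ Q.carrier → ∀ x, x ≠ 0 → w U x + w I x = w P x + w Q x
  smul : ∀ P x (t : ℝ), 0 < t → x ≠ 0 → w P (t • x) = t ^ (-p) * w P x
  map : ∀ (L : E n →ₗ[ℝ] E n), LinearMap.det L = 1 → ∀ P x, x ≠ 0 →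
    w (P.map L) x = w P (LinearMap.adjoint L x)
  countable : ∀ P, {u : Sph n | w P u ≠ 0}.Countable

/-- The direction of a nonzero vector. -/
def dir (x : E n) (hx : x ≠ 0) : Sph n :=
  ⟨‖x‖⁻¹ • x, by rw [mem_sphere_zero_iff_norm, norm_smul, norm_inv, norm_norm,
    inv_mul_cancel₀ (norm_ne_zero_iff.2 hx)]⟩

theorem norm_smul_dir (x : E n) (hx : x ≠ 0) : ‖x‖ • (dir x hx : E n) = x := by
  rw [dir, smul_smul, mul_inv_cancel₀ (norm_ne_zero_iff.2 hx), one_smul]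

theorem Sph.ne_zero (u : Sph n) : (u : E n) ≠ 0 := by
  have := mem_sphere_zero_iff_norm.1 u.2
  intro h
  rw [h, norm_zero] at this
  exact zero_ne_one this

theorem add_smul_ne_zero {x b : E n} (h : LinearIndependent ℝ ![x, b]) (s : ℝ) :
    x + s • b ≠ 0 := by
  intro h0
  have := (LinearIndependent.pair_iff.1 h 1 s (by rw [one_smul, h0])).1
  exact one_ne_zero this

theorem linearIndependent_pair_of_inner_eq_zero {x b : E n} (hx : x ≠ 0) (hb : b ≠ 0)
    (h : inner ℝ x b = 0) : LinearIndependent ℝ ![x, b] := by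
  rw [LinearIndependent.pair_iff]
  intro s t hst
  constructor
  · have := congrArg (fun z => (inner ℝ x z : ℝ)) hst
    simp only [inner_add_right, inner_smul_right, h, mul_zero, add_zero, inner_zero_right] at this
    exact (mul_eq_zero.1 this).resolve_right (inner_self_ne_zero.2 hx)
  · have := congrArg (fun z => (inner ℝ b z : ℝ)) hst
    simp only [inner_add_right, inner_smul_right, real_inner_comm, h, mul_zero, zero_add,
      inner_zero_right] at this
    exact (mul_eq_zero.1 this).resolve_right (inner_self_ne_zero.2 hb)

/-- The section of a polytope by a hyperplane through the origin. -/
def PolytopeO.sec (P : PolytopeO n) (a : E n) : PolytopeO n := (P.cut a).cut (-a)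

theorem PolytopeO.mem_sec {P : PolytopeO n} {a y : E n} :
    y ∈ (P.sec a).carrier ↔ y ∈ P.carrier ∧ inner ℝ a y = 0 := PolytopeO.mem_cut_cut_neg

namespace IsMassFunction

variable {w : PolytopeO n → E n → ℝ} (hw : IsMassFunction p w)
include hw

theorem ne_zero_dir {P : PolytopeO n} {x : E n} (hx : x ≠ 0) (h : w P x ≠ 0) :
    w P (dir x hx) ≠ 0 := by
  intro h0
  apply h
  rw [← norm_smul_dir x hx, hw.smul P _ _ (norm_pos_iff.2 hx) (Sph.ne_zero _), h0, mul_zero]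

/-- The vectors x + sb point in pairwise different directions, and an interval is uncountable, so
they cannot all carry mass. -/
theorem exists_eq_zero (P : PolytopeO n) {x b : E n} (h : LinearIndependent ℝ ![x, b]) :
    ∃ s ∈ Set.Icc (0 : ℝ) 1, w P (x + s • b) = 0 := by
  by_contra! hne
  let f : ℝ → Sph n := fun s => dir (x + s • b) (add_smul_ne_zero h s)
  have hf : Function.Injective f := by
    intro s t hst
    have h1 := congrArg Subtype.val hst
    simp only [f, dir] at h1
    rw [smul_add, smul_add, smul_smul, smul_smul, ← sub_eq_zero, add_sub_add_comm, ← sub_smul,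
      ← sub_smul] at h1
    obtain ⟨h2, h3⟩ := LinearIndependent.pair_iff.1 h _ _ h1
    rw [sub_eq_zero] at h2 h3
    rw [h2] at h3
    exact mul_left_cancel₀ (inv_ne_zero (norm_ne_zero_iff.2 (add_smul_ne_zero h t))) h3
  have hc : (Set.Icc (0 : ℝ) 1).Countable := by
    refine Set.MapsTo.countable_of_injOn (f := f) (fun s hs => ?_) hf.injOn (hw.countable P)
    exact hw.ne_zero_dir _ (hne s hs)
  have := hc.measure_zero volume
  rw [Real.volume_Icc] at this
  norm_num at this

theorem map_shear {b a : E n} (h : inner ℝ b a = 0) (P : PolytopeO n) {x : E n} (hx : x ≠ 0) :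
    w (P.map (shear b a)) x = w P (x + (inner ℝ a x : ℝ) • b) := by
  rw [hw.map _ (det_shear h) _ _ hx, adjoint_shear, shear_apply]

/-- Polytopes in a hyperplane have mass only in the normal directions. -/
theorem eq_zero_of_subset {P : PolytopeO n} {x b : E n} (h : LinearIndependent ℝ ![x, b])
    (hP : ∀ y ∈ P.carrier, inner ℝ b y = 0) : w P x = 0 := by
  obtain ⟨s, -, hs⟩ := hw.exists_eq_zero P h
  have hb : b ≠ 0 := h.ne_zero 1
  have hx : x ≠ 0 := h.ne_zero 0
  have hbb : (inner ℝ b b : ℝ) ≠ 0 := inner_self_ne_zero.2 hb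
  -- The component of x orthogonal to b. Since ⟨a, x⟩ = ⟨a, a⟩, the shear along (s/⟨a, a⟩)a fixes P
  -- pointwise while its adjoint sends x to x + sb, a direction without mass.
  let a := x + (-(inner ℝ b x / inner ℝ b b) : ℝ) • b
  have ha : a ≠ 0 := add_smul_ne_zero h _
  have hba : inner ℝ b a = 0 := by
    simp only [a, inner_add_right, inner_smul_right]
    field_simp
    ring
  have hax : inner ℝ a x = inner ℝ a a := by
    have : inner ℝ a a = inner ℝ a x + (-(inner ℝ b x / inner ℝ b b) : ℝ) * inner ℝ a b := by
      conv_lhs => rw [show a = x + (-(inner ℝ b x / inner ℝ b b) : ℝ) • b from rfl]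
      rw [inner_add_right, inner_smul_right]
    rw [this, real_inner_comm b a, hba, mul_zero, add_zero]
  have haa : (inner ℝ a a : ℝ) ≠ 0 := inner_self_ne_zero.2 ha
  have hmap : P.map (shear b ((s / inner ℝ a a : ℝ) • a)) = P := by
    have : ∀ y ∈ P.carrier, shear b ((s / inner ℝ a a : ℝ) • a) y = y := by
      intro y hy
      rw [shear_apply, hP y hy, zero_smul, add_zero]
    ext y
    constructor
    · rintro ⟨y, hy, rfl⟩
      rwa [this y hy]
    · intro hy
      exact ⟨y, hy, this y hy⟩
  have h1 := hw.map_shear (b := b) (a := (s / inner ℝ a a : ℝ) • a)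
    (by rw [inner_smul_right, hba, mul_zero]) P hx
  rw [hmap, inner_smul_left, hax, conj_trivial, div_mul_cancel₀ _ haa, hs] at h1
  exact h1

theorem add_sec (P : PolytopeO n) (a : E n) {x : E n} (hx : x ≠ 0) :
    w P x + w (P.sec a) x = w (P.cut a) x + w (P.cut (-a)) x := by
  refine hw.valuation _ _ _ _ ?_ ?_ x hx
  · ext y
    simp only [Set.mem_union, PolytopeO.mem_cut, inner_neg_left, neg_nonpos]
    have := le_total (inner ℝ a y) (0 : ℝ)
    tauto
  · ext y
    simp only [Set.mem_inter_iff, PolytopeO.mem_cut, PolytopeO.mem_sec, inner_neg_left, neg_nonpos,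
      le_antisymm_iff]
    tauto

/-- Available before sections are known to be null in their normal direction, and used to prove
that; `cut_add_cut` later removes the independence assumption when p ≠ 1. -/
theorem eq_cut_add_cut (P : PolytopeO n) {a x : E n} (h : LinearIndependent ℝ ![x, a]) :
    w P x = w (P.cut a) x + w (P.cut (-a)) x := by
  have hx : x ≠ 0 := h.ne_zero 0
  rw [← hw.add_sec P a hx, hw.eq_zero_of_subset h fun y hy => (PolytopeO.mem_sec.1 hy).2,
    add_zero]

end IsMassFunction

/-! ### Pyramids -/

/-- `P` is the part of the halfspace `⟪ℓ, y⟫ ≤ 1` in the cone in `L` given by the normals `M`. -/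
def IsPyramid (L : Submodule ℝ (E n)) (ℓ : E n) (M : Finset (E n)) (P : PolytopeO n) : Prop :=
  (M : Set (E n)) ⊆ L ∧ P.carrier = {y | y ∈ L ∧ inner ℝ ℓ y ≤ 1 ∧ ∀ m ∈ M, inner ℝ m y ≤ 0}

theorem IsPyramid.mem_iff {L : Submodule ℝ (E n)} {ℓ : E n} {M : Finset (E n)} {P : PolytopeO n}
    (h : IsPyramid L ℓ M P) {y : E n} :
    y ∈ P.carrier ↔ y ∈ L ∧ inner ℝ ℓ y ≤ 1 ∧ ∀ m ∈ M, inner ℝ m y ≤ 0 := by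
  rw [h.2]
  rfl

/-- Otherwise the whole ray through y would satisfy the inequalities, against boundedness. -/
theorem IsPyramid.inner_pos {L : Submodule ℝ (E n)} {ℓ : E n} {M : Finset (E n)} {P : PolytopeO n}
    (h : IsPyramid L ℓ M P) {y : E n} (hy : y ∈ P.carrier) (hy0 : y ≠ 0) : 0 < inner ℝ ℓ y := by
  by_contra! hneg
  refine hy0 (eq_zero_of_forall_smul_mem P.isCompact.isBounded fun t ht => ?_)
  obtain ⟨h1, h2, h3⟩ := h.mem_iff.1 hy
  refine h.mem_iff.2 ⟨L.smul_mem _ h1, ?_, fun m hm => ?_⟩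
  · rw [inner_smul_right]
    exact (mul_nonpos_of_nonneg_of_nonpos ht hneg).trans zero_le_one
  · rw [inner_smul_right]
    exact mul_nonpos_of_nonneg_of_nonpos ht (h3 m hm)

theorem IsPyramid.inv_smul_mem {L : Submodule ℝ (E n)} {ℓ : E n} {M : Finset (E n)}
    {P : PolytopeO n} (h : IsPyramid L ℓ M P) {y : E n} (hy : y ∈ P.carrier) (hy0 : y ≠ 0) :
    (inner ℝ ℓ y : ℝ)⁻¹ • y ∈ P.carrier := by
  have hpos := h.inner_pos hy hy0
  obtain ⟨h1, h2, h3⟩ := h.mem_iff.1 hy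
  refine h.mem_iff.2 ⟨L.smul_mem _ h1, ?_, fun m hm => ?_⟩
  · rw [inner_smul_right, inv_mul_cancel₀ hpos.ne']
  · rw [inner_smul_right]
    exact mul_nonpos_of_nonneg_of_nonpos (inv_nonneg.2 hpos.le) (h3 m hm)

/-- Every nonzero point rescales to the bounded base ⟨ℓ, y⟩ = 1. In coordinates A this encloses the
pyramid in a pyramid over a box. -/
theorem IsPyramid.exists_bound {L : Submodule ℝ (E n)} {ℓ : E n} {M : Finset (E n)}
    {P : PolytopeO n} (h : IsPyramid L ℓ M P) (A : E n →ₗ[ℝ] E n) :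
    ∃ R : ℕ, 0 < R ∧ ∀ y ∈ P.carrier, ∀ i, |A y i| ≤ R * inner ℝ ℓ y := by
  have hb := (P.isCompact.image A.continuous_of_finiteDimensional).isBounded
  obtain ⟨R, hR⟩ := hb.exists_norm_le
  obtain ⟨N, hN⟩ := exists_nat_ge R
  refine ⟨N + 1, Nat.succ_pos _, fun y hy i => ?_⟩
  by_cases hy0 : y = 0
  · simp [hy0]
  have hpos := h.inner_pos hy hy0
  have h1 := hR _ (Set.mem_image_of_mem A (h.inv_smul_mem hy hy0))
  have h2 := (PiLp.norm_apply_le (A ((inner ℝ ℓ y : ℝ)⁻¹ • y)) i).trans h1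
  rw [map_smul, PiLp.smul_apply, smul_eq_mul, Real.norm_eq_abs, abs_mul,
    abs_of_pos (inv_pos.2 hpos), inv_mul_le_iff₀ hpos] at h2
  refine h2.trans ?_
  rw [mul_comm]
  push_cast
  exact mul_le_mul_of_nonneg_right (hN.trans (by linarith)) hpos.le

theorem PolytopeO.exists_eq_in_submodule (L : Submodule ℝ (E n)) (P : PolytopeO n)
    (hP : P.carrier ⊆ L) : ∃ A M : Finset (E n), (A : Set (E n)) ⊆ L ∧ (M : Set (E n)) ⊆ L ∧
      P.carrier = {y | y ∈ L ∧ (∀ ℓ ∈ A, inner ℝ ℓ y ≤ 1) ∧ ∀ m ∈ M, inner ℝ m y ≤ 0} := by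
  classical
  obtain ⟨C, hC, h0⟩ := P.exists_eq_polyhedron
  have key : ∀ c y, y ∈ L → inner ℝ (L.starProjection c) y = inner ℝ c y := by
    intro c y hy
    rw [Submodule.inner_starProjection_left_eq_right, Submodule.starProjection_eq_self_iff.2 hy]
  refine ⟨(C.filter fun c => 0 < c.2).image fun c => L.starProjection (c.2⁻¹ • c.1),
    (C.filter fun c => ¬ 0 < c.2).image fun c => L.starProjection c.1, ?_, ?_, ?_⟩
  · intro z hz
    obtain ⟨c, -, rfl⟩ := Finset.mem_image.1 (Finset.mem_coe.1 hz)
    exact Submodule.starProjection_apply_mem _ _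
  · intro z hz
    obtain ⟨c, -, rfl⟩ := Finset.mem_image.1 (Finset.mem_coe.1 hz)
    exact Submodule.starProjection_apply_mem _ _
  · ext y
    have hPy : y ∈ P.carrier ↔ y ∈ L ∧ y ∈ P.carrier := ⟨fun h => ⟨hP h, h⟩, fun h => h.2⟩
    rw [hPy, Set.mem_ofPred_eq]
    refine and_congr_right fun hy => ?_
    simp only [Finset.forall_mem_image, Finset.mem_filter, key _ _ hy]
    rw [hC]
    constructor
    · intro h
      refine ⟨fun c hc => ?_, fun c hc => ?_⟩
      · rw [inner_smul_left, conj_trivial, inv_mul_le_iff₀ hc.2, mul_one]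
        exact h c hc.1
      · exact (h c hc.1).trans (not_lt.1 hc.2)
    · intro h c hc
      by_cases hpos : 0 < c.2
      · have := h.1 ⟨hc, hpos⟩
        rwa [inner_smul_left, conj_trivial, inv_mul_le_iff₀ hpos, mul_one] at this
      · exact (h.2 ⟨hc, hpos⟩).trans (h0 c hc)

/-- A function that is additive under cuts by hyperplanes through the origin is determined by its
values on pyramids. -/
theorem eq_zero_of_pyramid (L : Submodule ℝ (E n)) (D : PolytopeO n → ℝ)
    (hadd : ∀ P : PolytopeO n, P.carrier ⊆ L → ∀ a ∈ L, a ≠ 0 →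
      D P = D (P.cut a) + D (P.cut (-a)))
    (hpyr : ∀ P ℓ M, ℓ ∈ L → IsPyramid L ℓ M P → D P = 0) (P : PolytopeO n)
    (hP : P.carrier ⊆ L) : D P = 0 := by
  classical
  obtain ⟨A, M, hA, hM, hPe⟩ := P.exists_eq_in_submodule L hP
  induction hk : A.card using Nat.strong_induction_on generalizing A M P with
  | _ k ih =>
  by_cases h1 : A.card ≤ 1
  · rcases Finset.card_le_one_iff_subset_singleton.1 h1 with ⟨ℓ, hℓ⟩
    rcases Finset.subset_singleton_iff.1 hℓ with rfl | rfl
    · refine hpyr P 0 M L.zero_mem ⟨hM, ?_⟩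
      rw [hPe]
      simp
    · refine hpyr P ℓ M (hA (by simp)) ⟨hM, ?_⟩
      rw [hPe]
      simp
  · obtain ⟨ℓ, hℓ, ℓ', hℓ', hne⟩ := Finset.one_lt_card.1 (not_le.1 h1)
    -- Where ⟨ℓ, y⟩ ≤ ⟨ℓ', y⟩, the constraint of ℓ follows from that of ℓ'. Cutting along ℓ - ℓ'
    -- thus leaves two polytopes with one affine constraint fewer, at the price of one more
    -- homogeneous constraint.
    have step : ∀ ℓ ∈ A, ∀ ℓ' ∈ A, ℓ ≠ ℓ' → D (P.cut (ℓ - ℓ')) = 0 := by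
      intro ℓ hℓ ℓ' hℓ' hne
      refine ih (A.erase ℓ).card ?_ (P.cut (ℓ - ℓ')) ((P.cut_subset _).trans hP) (A.erase ℓ)
        (insert (ℓ - ℓ') M) ?_ ?_ ?_ rfl
      · rw [← hk]
        exact Finset.card_erase_lt_of_mem hℓ
      · exact (Finset.coe_subset.2 (Finset.erase_subset _ _)).trans hA
      · rw [Finset.coe_insert]
        exact Set.insert_subset (L.sub_mem (hA hℓ) (hA hℓ')) hM
      · ext y
        rw [PolytopeO.mem_cut, hPe]
        simp only [Set.mem_ofPred_eq, Finset.forall_mem_insert, Finset.mem_erase, inner_sub_left]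
        constructor
        · rintro ⟨⟨h1, h2, h3⟩, h4⟩
          exact ⟨h1, fun l hl => h2 l hl.2, h4, h3⟩
        · rintro ⟨h1, h2, h3, h4⟩
          refine ⟨⟨h1, fun l hl => ?_, h4⟩, h3⟩
          by_cases hl' : l = ℓ
          · rw [hl']
            have := h2 ℓ' ⟨hne.symm, hℓ'⟩
            linarith
          · exact h2 l ⟨hl', hl⟩
    rw [hadd P hP (ℓ - ℓ') (L.sub_mem (hA hℓ) (hA hℓ')) (sub_ne_zero.2 hne), neg_sub,
      step ℓ hℓ ℓ' hℓ' hne, step ℓ' hℓ' ℓ hℓ hne.symm, add_zero]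

/-- Monotonicity of nonnegative functions that are additive under cuts. -/
theorem le_of_isPyramid (L : Submodule ℝ (E n)) (C : PolytopeO n → Prop) (Z : PolytopeO n → ℝ)
    (hcut : ∀ P, C P → ∀ a ∈ L, C (P.cut a)) (hZ : ∀ P, C P → 0 ≤ Z P)
    (hadd : ∀ P, C P → ∀ a ∈ L, a ≠ 0 → Z P = Z (P.cut a) + Z (P.cut (-a)))
    {P Q : PolytopeO n} {ℓ : E n} {M : Finset (E n)} (hP : IsPyramid L ℓ M P) (hQ : C Q)
    (hQL : ∀ y ∈ Q.carrier, y ∈ L ∧ inner ℝ ℓ y ≤ 1) (hPQ : P.carrier ⊆ Q.carrier) :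
    Z P ≤ Z Q := by
  classical
  -- Since Q already satisfies ⟨ℓ, y⟩ ≤ 1, the linear half-spaces in M alone cut it down to P, and
  -- every cut discards a piece of nonnegative value.
  have key : ∀ M : Finset (E n), (M : Set (E n)) ⊆ L → ∀ Q, C Q → ∀ P : PolytopeO n,
      P.carrier = {y | y ∈ Q.carrier ∧ ∀ m ∈ M, inner ℝ m y ≤ 0} → Z P ≤ Z Q := by
    intro M
    induction M using Finset.induction_on with
    | empty =>
      intro _ Q _ P hP
      have : P = Q := PolytopeO.ext (by rw [hP]; simp)
      rw [this]
    | insert a M _ ih =>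
      intro hM Q hQ P hP
      rw [Finset.coe_insert, Set.insert_subset_iff] at hM
      have h1 : Z P ≤ Z (Q.cut a) := by
        refine ih hM.2 (Q.cut a) (hcut Q hQ a hM.1) P ?_
        rw [hP]
        ext y
        simp only [Set.mem_ofPred_eq, PolytopeO.mem_cut, Finset.forall_mem_insert, and_assoc]
      refine h1.trans ?_
      by_cases ha : a = 0
      · have : Q.cut a = Q := PolytopeO.ext (by ext y; simp [PolytopeO.mem_cut, ha])
        rw [this]
      · rw [hadd Q hQ a hM.1 ha]
        have := hZ _ (hcut Q hQ (-a) (L.neg_mem hM.1))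
        linarith
  refine key M hP.1 Q hQ P ?_
  ext y
  rw [hP.mem_iff, Set.mem_ofPred_eq]
  constructor
  · intro h
    exact ⟨hPQ (hP.mem_iff.2 h), h.2.2⟩
  · rintro ⟨h1, h2⟩
    exact ⟨(hQL y h1).1, (hQL y h1).2, h2⟩

/-! ### Pyramids over boxes -/

theorem exists_boxPyramid (k : Fin n) (lo hi : Fin n → ℝ) : ∃ P : PolytopeO n, ∀ y,
    y ∈ P.carrier ↔ (0 ≤ y k ∧ y k ≤ 1) ∧ ∀ i, i ≠ k → lo i * y k ≤ y i ∧ y i ≤ hi i * y k := by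
  classical
  let A : Finset (E n × ℝ) := {(-unitVec k, 0), (unitVec k, 1)} ∪
    ((Finset.univ.filter (· ≠ k)).image (fun i => (lo i • unitVec k - unitVec i, (0 : ℝ))) ∪
      (Finset.univ.filter (· ≠ k)).image (fun i => (unitVec i - hi i • unitVec k, (0 : ℝ))))
  have hA : ∀ y, y ∈ polyhedron (A : Set (E n × ℝ)) ↔ (0 ≤ y k ∧ y k ≤ 1) ∧
      ∀ i, i ≠ k → lo i * y k ≤ y i ∧ y i ≤ hi i * y k := by
    intro y
    have : y ∈ polyhedron (A : Set (E n × ℝ)) ↔ ∀ c ∈ A, inner ℝ c.1 y ≤ c.2 := Iff.rfl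
    rw [this]
    simp only [A, Finset.forall_mem_union, Finset.forall_mem_image, Finset.forall_mem_insert,
      Finset.mem_singleton, forall_eq, Finset.mem_filter, Finset.mem_univ, true_and,
      inner_sub_left, inner_neg_left, inner_smul_left, inner_unitVec, conj_trivial, sub_nonpos,
      neg_nonpos, forall_and]
  suffices h : Bornology.IsBounded (polyhedron (A : Set (E n × ℝ))) ∧ ∀ c ∈ A, 0 ≤ c.2 by
    obtain ⟨P, hP⟩ := exists_polytope_eq_polyhedron A h.1 h.2
    exact ⟨P, fun y => by rw [hP, hA]⟩
  constructor
  · rw [isBounded_iff_forall_norm_le]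
    refine ⟨Real.sqrt (∑ i, (|lo i| + |hi i| + 1) ^ 2), fun y hy => ?_⟩
    rw [EuclideanSpace.norm_eq]
    refine Real.sqrt_le_sqrt (Finset.sum_le_sum fun i _ => ?_)
    obtain ⟨⟨h0, h1⟩, h⟩ := (hA y).1 hy
    refine pow_le_pow_left₀ (norm_nonneg _) ?_ 2
    rw [Real.norm_eq_abs, abs_le]
    by_cases hi' : i = k
    · subst hi'
      have := abs_nonneg (lo i)
      have := abs_nonneg (hi i)
      constructor <;> linarith
    · obtain ⟨h2, h3⟩ := h i hi'
      have h4 : |lo i * y k| ≤ |lo i| := by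
        rw [abs_mul, abs_of_nonneg h0]
        exact mul_le_of_le_one_right (abs_nonneg _) h1
      have h5 : |hi i * y k| ≤ |hi i| := by
        rw [abs_mul, abs_of_nonneg h0]
        exact mul_le_of_le_one_right (abs_nonneg _) h1
      have := (abs_le.1 h4).1
      have := (abs_le.1 h5).2
      have := abs_nonneg (lo i)
      have := abs_nonneg (hi i)
      constructor <;> linarith
  · intro c hc
    simp only [A, Finset.mem_union, Finset.mem_insert, Finset.mem_singleton, Finset.mem_image] at hc
    rcases hc with (rfl | rfl) | ⟨i, -, rfl⟩ | ⟨i, -, rfl⟩ <;> simp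

/-- The pyramid with apex `0` over the box `{y | y k = 1, lo i ≤ y i ≤ hi i}`. -/
def boxPyramid (k : Fin n) (lo hi : Fin n → ℝ) : PolytopeO n := (exists_boxPyramid k lo hi).choose

theorem mem_boxPyramid {k : Fin n} {lo hi : Fin n → ℝ} {y : E n} :
    y ∈ (boxPyramid k lo hi).carrier ↔
      (0 ≤ y k ∧ y k ≤ 1) ∧ ∀ i, i ≠ k → lo i * y k ≤ y i ∧ y i ≤ hi i * y k :=
  (exists_boxPyramid k lo hi).choose_spec y

theorem isPyramid_boxPyramid (k : Fin n) (lo hi : Fin n → ℝ) :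
    ∃ M, IsPyramid ⊤ (unitVec k) M (boxPyramid k lo hi) := by
  classical
  refine ⟨{-unitVec k} ∪ ((Finset.univ.filter (· ≠ k)).image (fun i => lo i • unitVec k - unitVec i) ∪
      (Finset.univ.filter (· ≠ k)).image (fun i => unitVec i - hi i • unitVec k)),
      Set.subset_univ _, ?_⟩
  ext y
  simp only [Finset.forall_mem_union, Finset.forall_mem_image,
      Finset.mem_singleton, forall_eq, Finset.mem_filter, Finset.mem_univ, true_and,
      inner_sub_left, inner_neg_left, inner_smul_left, inner_unitVec, conj_trivial, sub_nonpos,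
      neg_nonpos, Set.mem_ofPred_eq, Submodule.mem_top, mem_boxPyramid, forall_and]
  tauto

theorem boxPyramid_map_shear {k : Fin n} (lo hi : Fin n → ℝ) {c : E n} (hc : c k = 0) :
    (boxPyramid k lo hi).map (shear (unitVec k) c) =
      boxPyramid k (fun i => lo i + c i) (fun i => hi i + c i) := by
  have happ : ∀ (c : E n) (y : E n) i, shear (unitVec k) c y i = y i + y k * c i := by
    intro c y i
    rw [shear_apply, inner_unitVec]
    simp
  ext y
  constructor
  · rintro ⟨x, hx, rfl⟩
    obtain ⟨h1, h2⟩ := mem_boxPyramid.1 hx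
    rw [mem_boxPyramid]
    simp only [happ, hc, mul_zero, add_zero]
    refine ⟨h1, fun i hi' => ?_⟩
    obtain ⟨h3, h4⟩ := h2 i hi'
    constructor <;> linarith
  · intro hy
    obtain ⟨h1, h2⟩ := mem_boxPyramid.1 hy
    refine ⟨shear (unitVec k) (-c) y, ?_, ?_⟩
    · rw [mem_boxPyramid]
      simp only [happ, PiLp.neg_apply, hc, neg_zero, mul_zero, add_zero]
      refine ⟨h1, fun i hi' => ?_⟩
      obtain ⟨h3, h4⟩ := h2 i hi'
      constructor <;> linarith
    · ext i
      simp only [happ, PiLp.neg_apply, hc, neg_zero, mul_zero, add_zero]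
      ring

theorem boxPyramid_map_diag {k : Fin n} (lo hi d : Fin n → ℝ) (hd : ∀ i, 0 < d i) (hk : d k = 1) :
    (boxPyramid k lo hi).map (diag d) =
      boxPyramid k (fun i => d i * lo i) (fun i => d i * hi i) := by
  ext y
  constructor
  · rintro ⟨x, hx, rfl⟩
    obtain ⟨h1, h2⟩ := mem_boxPyramid.1 hx
    rw [mem_boxPyramid]
    simp only [diag_apply, hk, one_mul, mul_assoc]
    exact ⟨h1, fun i hi' => ⟨mul_le_mul_of_nonneg_left (h2 i hi').1 (hd i).le,
      mul_le_mul_of_nonneg_left (h2 i hi').2 (hd i).le⟩⟩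
  · intro hy
    obtain ⟨h1, h2⟩ := mem_boxPyramid.1 hy
    refine ⟨diag d⁻¹ y, ?_, ?_⟩
    · rw [mem_boxPyramid]
      simp only [diag_apply, Pi.inv_apply, hk, inv_one, one_mul]
      refine ⟨h1, fun i hi' => ?_⟩
      rw [le_inv_mul_iff₀ (hd i), inv_mul_le_iff₀ (hd i), ← mul_assoc, ← mul_assoc]
      exact h2 i hi'
    · ext i
      simp only [diag_apply, Pi.inv_apply]
      rw [mul_inv_cancel_left₀ (hd i).ne']

theorem boxPyramid_cut {k j : Fin n} (hj : j ≠ k) (lo hi : Fin n → ℝ) {c : ℝ} (hc : c ≤ hi j) :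
    (boxPyramid k lo hi).cut (unitVec j - c • unitVec k) =
      boxPyramid k lo (Function.update hi j c) := by
  ext y
  simp only [PolytopeO.mem_cut, mem_boxPyramid, inner_sub_left, inner_smul_left, inner_unitVec,
    conj_trivial, sub_nonpos]
  constructor
  · rintro ⟨⟨h1, h2⟩, h3⟩
    refine ⟨h1, fun i hi' => ⟨(h2 i hi').1, ?_⟩⟩
    by_cases hij : i = j
    · subst hij; simpa using h3
    · rw [Function.update_of_ne hij]; exact (h2 i hi').2
  · rintro ⟨h1, h2⟩
    refine ⟨⟨h1, fun i hi' => ⟨(h2 i hi').1, ?_⟩⟩, by simpa using (h2 j hj).2⟩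
    by_cases hij : i = j
    · subst hij
      have := (h2 i hi').2
      rw [Function.update_self] at this
      exact this.trans (mul_le_mul_of_nonneg_right hc h1.1)
    · have := (h2 i hi').2
      rwa [Function.update_of_ne hij] at this

theorem boxPyramid_cut_neg {k j : Fin n} (hj : j ≠ k) (lo hi : Fin n → ℝ) {c : ℝ} (hc : lo j ≤ c) :
    (boxPyramid k lo hi).cut (-(unitVec j - c • unitVec k)) =
      boxPyramid k (Function.update lo j c) hi := by
  ext y
  simp only [PolytopeO.mem_cut, mem_boxPyramid, inner_neg_left, inner_sub_left, inner_smul_left,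
    inner_unitVec, conj_trivial, neg_nonpos, sub_nonneg]
  constructor
  · rintro ⟨⟨h1, h2⟩, h3⟩
    refine ⟨h1, fun i hi' => ⟨?_, (h2 i hi').2⟩⟩
    by_cases hij : i = j
    · subst hij; simpa using h3
    · rw [Function.update_of_ne hij]; exact (h2 i hi').1
  · rintro ⟨h1, h2⟩
    refine ⟨⟨h1, fun i hi' => ⟨?_, (h2 i hi').2⟩⟩, by simpa using (h2 j hj).1⟩
    by_cases hij : i = j
    · subst hij
      have := (h2 i hi').1
      rw [Function.update_self] at this
      exact (mul_le_mul_of_nonneg_right hc h1.1).trans this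
    · have := (h2 i hi').1
      rwa [Function.update_of_ne hij] at this

end

section

/-! ### Lower-dimensional polytopes -/

theorem linearIndependent_or_eq_smul {n : ℕ} {x b : E n} (hb : b ≠ 0) :
    LinearIndependent ℝ ![x, b] ∨ ∃ c : ℝ, x = c • b := by
  by_cases h : LinearIndependent ℝ ![x, b]
  · exact Or.inl h
  · rw [LinearIndependent.pair_symm_iff, LinearIndependent.pair_iff' hb] at h
    push Not at h
    obtain ⟨c, hc⟩ := h
    exact Or.inr ⟨c, hc.symm⟩

theorem unitVec_ne_zero {n : ℕ} (i : Fin n) : (unitVec i : E n) ≠ 0 := by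
  intro h
  have := congrArg (fun y : E n => y i) h
  simp at this

theorem zero_ne_one_fin {m : ℕ} : (0 : Fin (m + 3)) ≠ 1 := fun h => by
  have := congrArg Fin.val h
  rw [Fin.val_one] at this
  simp at this

namespace IsMassFunction

variable {m : ℕ} {p : ℝ} {w : PolytopeO (m + 3) → E (m + 3) → ℝ} (hw : IsMassFunction p w)
include hw

/-- The flat pyramid lies in {y₀ = 0}. Each of its halves by {y₂ = 0} is its image under a shear and
a diagonal map of determinant one, whose adjoint doubles e₀. Hence w = 2 · 2^(-p) w, and w = 0 since
p ≠ 1. -/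
theorem boxPyramid_eq_zero (hp : p ≠ 1) (N : ℝ) (hN : 0 ≤ N) {c : ℝ} (hc : c ≠ 0) :
    w (boxPyramid 1 (fun i => if i = 0 then 0 else -N) (fun i => if i = 0 then 0 else N))
      (c • unitVec 0) = 0 := by
  set lo : Fin (m + 3) → ℝ := fun i => if i = 0 then 0 else -N with hlo
  set hi : Fin (m + 3) → ℝ := fun i => if i = 0 then 0 else N with hhi
  set B := boxPyramid 1 lo hi
  -- On B this map only halves coordinate 2: the compensating factor 2 acts on coordinate 0, which
  -- vanishes on B but is the direction of the mass.
  let d : Fin (m + 3) → ℝ := fun i => if i = 0 then 2 else if i = 2 then 1 / 2 else 1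
  have h01 := zero_ne_one_fin (m := m)
  have h02 := zero_ne_two_fin (m := m)
  have h12 := one_ne_two_fin (m := m)
  have hd0 : d 0 = 2 := if_pos rfl
  have hd1 : d 1 = 1 := by simp only [d, h01.symm, h12, if_false]
  have hd2 : d 2 = 1 / 2 := by simp only [d, h02.symm, if_false, if_true]
  have hdpos : ∀ i, 0 < d i := by
    intro i
    simp only [d]
    split_ifs <;> norm_num
  have hddet : LinearMap.det (diag d) = 1 := by
    rw [det_diag, ← Finset.mul_prod_erase Finset.univ d (Finset.mem_univ 0),
      ← Finset.mul_prod_erase _ d (Finset.mem_erase.2 ⟨h02.symm, Finset.mem_univ 2⟩),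
      Finset.prod_eq_one, hd0, hd2]
    · norm_num
    · intro i hi'
      simp only [Finset.mem_erase] at hi'
      simp only [d, hi'.1, hi'.2.1, if_false]
  have hx0 : c • unitVec (0 : Fin (m + 3)) ≠ 0 := smul_ne_zero hc (unitVec_ne_zero 0)
  have half : ∀ s : ℝ, w ((B.map (shear (unitVec 1) (s • unitVec 2))).map (diag d))
      (c • unitVec 0) = 2 ^ (-p) * w B (c • unitVec 0) := by
    intro s
    rw [hw.map _ hddet _ _ hx0, adjoint_diag, map_smul, diag_unitVec, hd0, smul_comm,
      hw.smul _ _ _ two_pos hx0, hw.map_shear _ _ hx0]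
    · congr 2
      rw [inner_smul_left, inner_unitVec]
      simp [h02.symm]
    · rw [inner_smul_right, inner_unitVec]
      simp [h12]
  have key : ∀ s : ℝ, (B.map (shear (unitVec 1) (s • unitVec 2))).map (diag d) =
      boxPyramid 1 (fun i => d i * (lo i + s * if i = 2 then 1 else 0))
        (fun i => d i * (hi i + s * if i = 2 then 1 else 0)) := by
    intro s
    rw [boxPyramid_map_shear _ _ (by simp [h12]), boxPyramid_map_diag _ _ _ hdpos hd1]
    congr 1 <;> (funext i; simp)
  have hcut : B.cut (unitVec 2 - (0 : ℝ) • unitVec 1) =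
      (B.map (shear (unitVec 1) ((-N) • unitVec 2))).map (diag d) := by
    rw [boxPyramid_cut h12.symm _ _ (by simp [hhi, h02.symm, hN]), key]
    congr 1 <;> funext i
    · by_cases hi2 : i = 2
      · simp only [hi2, hd2, hlo, h02.symm, if_false, if_true]; ring
      · by_cases hi0 : i = 0
        · simp [hi0, hlo, h02]
        · simp [d, hi0, hlo, hi2]
    · by_cases hi2 : i = 2
      · simp only [hi2, hd2, hhi, h02.symm, if_false, if_true, Function.update_self]; ring
      · by_cases hi0 : i = 0
        · simp [hi0, hhi, h02]
        · simp [d, hi0, hhi, hi2]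
  have hcut' : B.cut (-(unitVec 2 - (0 : ℝ) • unitVec 1)) =
      (B.map (shear (unitVec 1) (N • unitVec 2))).map (diag d) := by
    rw [boxPyramid_cut_neg h12.symm _ _ (by simp [hlo, h02.symm, hN]), key]
    congr 1 <;> funext i
    · by_cases hi2 : i = 2
      · simp only [hi2, hd2, hlo, h02.symm, if_false, if_true, Function.update_self]; ring
      · by_cases hi0 : i = 0
        · simp [hi0, hlo, h02]
        · simp [d, hi0, hlo, hi2]
    · by_cases hi2 : i = 2
      · simp only [hi2, hd2, hhi, h02.symm, if_false, if_true]; ring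
      · by_cases hi0 : i = 0
        · simp [hi0, hhi, h02]
        · simp [d, hi0, hhi, hi2]
  have hadd := hw.eq_cut_add_cut B (x := c • unitVec 0) (a := unitVec 2 - (0 : ℝ) • unitVec 1)
    (linearIndependent_pair_of_inner_eq_zero hx0
      (by rw [zero_smul, sub_zero]; exact unitVec_ne_zero 2)
      (by rw [inner_smul_left, inner_unitVec]; simp [h02]))
  rw [hcut, hcut', half, half, ← two_mul, ← mul_assoc] at hadd
  have hpow : (2 : ℝ) * 2 ^ (-p) ≠ 1 := by
    have : (2 : ℝ) * 2 ^ (-p) = 2 ^ (1 - p) := by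
      rw [sub_eq_add_neg, Real.rpow_add two_pos, Real.rpow_one]
    rw [this]
    intro h
    rw [← Real.rpow_zero 2, Real.rpow_right_inj two_pos (by norm_num)] at h
    exact hp (by linarith)
  by_contra hne
  exact hpow (mul_right_cancel₀ hne (by rw [one_mul]; exact hadd.symm))

theorem eq_zero_of_eq_singleton {P : PolytopeO (m + 3)} (hP : P.carrier ⊆ {0}) {x : E (m + 3)}
    (hx : x ≠ 0) : w P x = 0 := by
  obtain ⟨b, hb⟩ := exists_linearIndependent_pair_of_one_lt_finrank (R := ℝ)
    (by rw [finrank_euclideanSpace_fin]; omega) hx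
  refine hw.eq_zero_of_subset hb fun y hy => ?_
  rw [Set.mem_singleton_iff.1 (hP hy), inner_zero_right]

/-- Cuts by normals in the hyperplane are additive in direction e₀, so pyramids in the hyperplane
suffice. Such a pyramid lies in a volume-preserving image of the flat box pyramid, which has no
mass, and monotonicity applies. -/
theorem eq_zero_of_inner_unitVec (hp : p ≠ 1) {P : PolytopeO (m + 3)}
    (hP : ∀ y ∈ P.carrier, inner ℝ (unitVec 0) y = 0) {c : ℝ} (hc : c ≠ 0) :
    w P (c • unitVec 0) = 0 := by
  have hx0 : c • unitVec (0 : Fin (m + 3)) ≠ 0 := smul_ne_zero hc (unitVec_ne_zero 0)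
  let L : Submodule ℝ (E (m + 3)) := (ℝ ∙ unitVec 0)ᗮ
  have hL : ∀ y, y ∈ L ↔ inner ℝ (unitVec 0) y = 0 := fun y =>
    Submodule.mem_orthogonal_singleton_iff_inner_right
  have hadd : ∀ P : PolytopeO (m + 3), P.carrier ⊆ L → ∀ a ∈ L, a ≠ 0 →
      w P (c • unitVec 0) = w (P.cut a) (c • unitVec 0) + w (P.cut (-a)) (c • unitVec 0) := by
    intro P _ a ha ha0
    exact hw.eq_cut_add_cut P (linearIndependent_pair_of_inner_eq_zero hx0 ha0
      (by rw [inner_smul_left, (hL a).1 ha, mul_zero]))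
  refine eq_zero_of_pyramid L (fun P => w P (c • unitVec 0)) hadd ?_ P fun y hy => (hL y).2 (hP y hy)
  intro P ℓ M hℓ hPyr
  by_cases hℓ0 : ℓ = 0
  · refine hw.eq_zero_of_eq_singleton (fun y hy => ?_) hx0
    by_contra hy0
    have := hPyr.inner_pos hy hy0
    rw [hℓ0, inner_zero_left] at this
    exact this.false
  have hli := linearIndependent_pair_of_inner_eq_zero (unitVec_ne_zero 0) hℓ0 ((hL ℓ).1 hℓ)
  obtain ⟨A, hA, hA', h0, h1, h0', h1'⟩ := exists_det_eq_one_adjoint hli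
  obtain ⟨R, hR0, hR⟩ := hPyr.exists_bound A
  have hAy : ∀ y, A y 1 = inner ℝ ℓ y ∧ A y 0 = inner ℝ (unitVec 0) y := by
    intro y
    rw [← inner_unitVec, ← inner_unitVec]
    constructor
    · rw [← h1, LinearMap.adjoint_inner_left]
      rfl
    · conv_rhs => rw [← h0, LinearMap.adjoint_inner_left]
      rfl
  set B := boxPyramid (1 : Fin (m + 3)) (fun i => if i = 0 then 0 else -(R : ℝ))
    (fun i => if i = 0 then 0 else (R : ℝ)) with hB
  have hQ0 : w (B.map (A.symm : E (m + 3) →ₗ[ℝ] E (m + 3))) (c • unitVec 0) = 0 := by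
    rw [hw.map _ hA' _ _ hx0, map_smul, h0']
    exact hw.boxPyramid_eq_zero hp R (Nat.cast_nonneg R) hc
  have hQ : ∀ y ∈ (B.map (A.symm : E (m + 3) →ₗ[ℝ] E (m + 3))).carrier,
      y ∈ L ∧ inner ℝ ℓ y ≤ 1 := by
    intro y hy
    rw [PolytopeO.mem_map_equiv, LinearEquiv.symm_symm, hB, mem_boxPyramid] at hy
    rw [hL, ← (hAy y).1, ← (hAy y).2]
    have := hy.2 0 zero_ne_one_fin
    simp only [if_true, zero_mul] at this
    exact ⟨le_antisymm this.2 this.1, hy.1.2⟩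
  refine le_antisymm ?_ (hw.nonneg _ _)
  have hmono := le_of_isPyramid L (fun P => P.carrier ⊆ L) (fun P => w P (c • unitVec 0))
    (fun P hP a _ => (P.cut_subset a).trans hP) (fun P _ => hw.nonneg _ _) hadd hPyr
    (Q := B.map (A.symm : E (m + 3) →ₗ[ℝ] E (m + 3))) (fun y hy => (hQ y hy).1) hQ ?_
  · exact hmono.trans hQ0.le
  · intro y hy
    rw [PolytopeO.mem_map_equiv, LinearEquiv.symm_symm, hB, mem_boxPyramid]
    have hmem := hPyr.mem_iff.1 hy
    rw [(hAy y).1]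
    refine ⟨⟨?_, hmem.2.1⟩, fun i hi => ?_⟩
    · have := (abs_nonneg _).trans (hR y hy 0)
      exact nonneg_of_mul_nonneg_right this (Nat.cast_pos.2 hR0)
    · have h2 := abs_le.1 (hR y hy i)
      split_ifs with hi0
      · rw [hi0, (hAy y).2, (hL y).1 hmem.1]
        simp
      · rw [neg_mul]
        exact h2

/-- A mass function vanishes on polytopes of dimension less than `n`. -/
theorem eq_zero_of_inner_eq_zero (hp : p ≠ 1) {P : PolytopeO (m + 3)} {b x : E (m + 3)}
    (hb : b ≠ 0) (hx : x ≠ 0) (hP : ∀ y ∈ P.carrier, inner ℝ b y = 0) : w P x = 0 := by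
  rcases linearIndependent_or_eq_smul (x := x) hb with h | ⟨c, rfl⟩
  · exact hw.eq_zero_of_subset h hP
  · have hc : c ≠ 0 := fun h => hx (by rw [h, zero_smul])
    obtain ⟨v, hv⟩ := exists_linearIndependent_pair_of_one_lt_finrank (R := ℝ)
      (by rw [finrank_euclideanSpace_fin]; omega) hb
    obtain ⟨A, hA, -, h0, -⟩ := exists_det_eq_one_adjoint hv
    have := hw.map _ hA P (c • unitVec 0) (smul_ne_zero hc (unitVec_ne_zero 0))
    rw [map_smul, h0] at this
    rw [← this]
    refine hw.eq_zero_of_inner_unitVec hp ?_ hc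
    rintro _ ⟨y, hy, rfl⟩
    rw [← LinearMap.adjoint_inner_left, h0, hP y hy]

theorem cut_add_cut (hp : p ≠ 1) (P : PolytopeO (m + 3)) {a x : E (m + 3)} (ha : a ≠ 0)
    (hx : x ≠ 0) : w P x = w (P.cut a) x + w (P.cut (-a)) x := by
  rw [← hw.add_sec P a hx, hw.eq_zero_of_inner_eq_zero hp ha hx
    fun y hy => (PolytopeO.mem_sec.1 hy).2, add_zero]

/-- A pyramid has mass only in the direction of the normal of its base. -/
theorem eq_zero_of_isPyramid (hp : p ≠ 1) {P : PolytopeO (m + 3)} {ℓ x : E (m + 3)}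
    {M : Finset (E (m + 3))} (hPyr : IsPyramid ⊤ ℓ M P) (h : LinearIndependent ℝ ![ℓ, x]) :
    w P x = 0 := by
  have hx : x ≠ 0 := h.ne_zero 1
  obtain ⟨A, hA, hA', h0, h1, h0', h1'⟩ := exists_det_eq_one_adjoint h
  obtain ⟨R, hR0, hR⟩ := hPyr.exists_bound A
  have hAy : ∀ y, A y 0 = inner ℝ ℓ y := by
    intro y
    rw [← h0, LinearMap.adjoint_inner_left, ← inner_unitVec]
    rfl
  -- The margin 1 beyond R keeps the pyramid inside after a shear by any s in [0, 1]; s is then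
  -- chosen so that e₁ + s e₀ carries no mass of B.
  set B := boxPyramid (0 : Fin (m + 3)) (fun _ => -(R + 1 : ℝ)) (fun _ => (R + 1 : ℝ)) with hB
  have hli : LinearIndependent ℝ ![unitVec (1 : Fin (m + 3)), unitVec 0] :=
    linearIndependent_pair_of_inner_eq_zero (unitVec_ne_zero 1) (unitVec_ne_zero 0)
      (by rw [inner_unitVec]; simp [zero_ne_one_fin.symm])
  obtain ⟨s, hs, hs0⟩ := hw.exists_eq_zero B hli
  set Q := (B.map (shear (unitVec 0) (s • unitVec 1))).map (A.symm : E (m + 3) →ₗ[ℝ] E (m + 3))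
    with hQdef
  have hQ0 : w Q x = 0 := by
    rw [hQdef, hw.map _ hA' _ _ hx, h1', hw.map_shear _ _ (unitVec_ne_zero 1), inner_smul_left,
      inner_unitVec]
    · simpa using hs0
    · rw [inner_smul_right, inner_unitVec]
      simp
  have hmemQ : ∀ y, y ∈ Q.carrier ↔ (0 ≤ inner ℝ ℓ y ∧ inner ℝ ℓ y ≤ 1) ∧ ∀ i, i ≠ 0 →
      (-(R + 1 : ℝ) + s * if i = 1 then 1 else 0) * inner ℝ ℓ y ≤ A y i ∧
      A y i ≤ ((R + 1 : ℝ) + s * if i = 1 then 1 else 0) * inner ℝ ℓ y := by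
    intro y
    rw [hQdef, PolytopeO.mem_map_equiv, LinearEquiv.symm_symm, hB,
      boxPyramid_map_shear _ _ (by simp), mem_boxPyramid, hAy]
    simp
  refine le_antisymm ?_ (hw.nonneg _ _)
  refine (le_of_isPyramid ⊤ (fun _ => True) (fun P => w P x) (fun _ _ _ _ => trivial)
    (fun P _ => hw.nonneg _ _) (fun P _ a _ ha => hw.cut_add_cut hp P ha hx) hPyr
    (Q := Q) trivial (fun y hy => ⟨Submodule.mem_top, ((hmemQ y).1 hy).1.2⟩) ?_).trans hQ0.le
  intro y hy
  have hpos : 0 ≤ inner ℝ ℓ y :=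
    nonneg_of_mul_nonneg_right ((abs_nonneg _).trans (hR y hy 0)) (Nat.cast_pos.2 hR0)
  refine (hmemQ y).2 ⟨⟨hpos, (hPyr.mem_iff.1 hy).2.1⟩, fun i _ => ?_⟩
  have h2 := abs_le.1 (hR y hy i)
  have h3 : 0 ≤ s * inner ℝ ℓ y := mul_nonneg hs.1 hpos
  have h4 : s * inner ℝ ℓ y ≤ inner ℝ ℓ y := mul_le_of_le_one_left hpos hs.2
  simp only [LinearEquiv.coe_coe] at h2
  split_ifs <;> constructor <;> linarith

end IsMassFunction

end

section

/-! ### Translation-invariant functions on pyramids -/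

section Base
variable {d : ℕ}

/-- The embedding of `ℝᵈ` as the hyperplane `y 0 = 1`. -/
def lift (z : Fin d → ℝ) : E (d + 1) := WithLp.toLp 2 (Fin.cons 1 z)

@[simp] theorem lift_zero (z : Fin d → ℝ) : lift z 0 = 1 := rfl

@[simp] theorem lift_succ (z : Fin d → ℝ) (i : Fin d) : lift z i.succ = z i := rfl

theorem continuous_lift : Continuous (lift : (Fin d → ℝ) → E (d + 1)) := by
  refine (PiLp.continuous_toLp 2 _).comp (continuous_pi fun i => ?_)
  refine Fin.cases ?_ (fun j => ?_) i
  · simpa using continuous_const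
  · simpa using continuous_apply j

/-- The section of a polytope by the hyperplane `y 0 = 1`. -/
def base (P : PolytopeO (d + 1)) : Set (Fin d → ℝ) := {z | lift z ∈ P.carrier}

theorem isClosed_base (P : PolytopeO (d + 1)) : IsClosed (base P) :=
  P.isCompact.isClosed.preimage continuous_lift

theorem isBounded_base (P : PolytopeO (d + 1)) : Bornology.IsBounded (base P) := by
  obtain ⟨R, hR⟩ := P.isCompact.isBounded.exists_norm_le
  rw [isBounded_iff_forall_norm_le]
  refine ⟨R, fun z hz => ?_⟩
  have h0 := hR _ hz
  rw [pi_norm_le_iff_of_nonneg ((norm_nonneg _).trans h0)]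
  intro i
  have := (PiLp.norm_apply_le (lift z) i.succ).trans h0
  rwa [lift_succ] at this

theorem convex_base (P : PolytopeO (d + 1)) : Convex ℝ (base P) := by
  intro z hz z' hz' a b ha hb hab
  have : lift (a • z + b • z') = a • lift z + b • lift z' := by
    ext i
    refine Fin.cases ?_ (fun j => ?_) i
    · simp [hab]
    · simp
  show lift (a • z + b • z') ∈ P.carrier
  rw [this]
  exact P.convex hz hz' ha hb hab

/-- The volume of the section by the hyperplane `y 0 = 1`. -/
def baseVol (P : PolytopeO (d + 1)) : ℝ := volume.real (base P)

/-- Subadditivity is enough to turn the lower bound `mul_baseVol_le` into an upper bound. -/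
theorem baseVol_le_add (P : PolytopeO (d + 1)) (a : E (d + 1)) :
    baseVol P ≤ baseVol (P.cut a) + baseVol (P.cut (-a)) := by
  refine le_trans (measureReal_mono ?_ ?_) (measureReal_union_le _ _)
  · intro z hz
    rcases le_total (inner ℝ a (lift z)) (0 : ℝ) with h | h
    · exact Or.inl (PolytopeO.mem_cut.2 ⟨hz, h⟩)
    · exact Or.inr (PolytopeO.mem_cut.2 ⟨hz, by rwa [inner_neg_left, neg_nonpos]⟩)
  · exact ((isBounded_base _).union (isBounded_base _)).measure_lt_top.ne

/-- The pyramid over a box in the hyperplane `y 0 = 1`. -/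
def box (a b : Fin d → ℝ) : PolytopeO (d + 1) := boxPyramid 0 (Fin.cons 1 a) (Fin.cons 1 b)

theorem mem_box {a b : Fin d → ℝ} {y : E (d + 1)} : y ∈ (box a b).carrier ↔
    (0 ≤ y 0 ∧ y 0 ≤ 1) ∧ ∀ i : Fin d, a i * y 0 ≤ y i.succ ∧ y i.succ ≤ b i * y 0 := by
  rw [box, mem_boxPyramid]
  refine and_congr_right fun _ => ⟨fun h i => h i.succ (Fin.succ_ne_zero i), fun h i => ?_⟩
  refine Fin.cases (fun h0 => absurd rfl h0) (fun j _ => h j) i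

theorem base_box (a b : Fin d → ℝ) : base (box a b) = Set.Icc a b := by
  ext z
  show lift z ∈ (box a b).carrier ↔ _
  rw [mem_box, Set.mem_Icc, Pi.le_def, Pi.le_def]
  simp [forall_and]

/-- Nonnegative functions on polytopes which are additive under cuts by hyperplanes through the
origin and invariant under the shears which translate the hyperplane `y 0 = 1`. -/
structure IsInvariant (Z : PolytopeO (d + 1) → ℝ) : Prop where
  nonneg : ∀ P, 0 ≤ Z P
  cut_add_cut : ∀ P a, a ≠ 0 → Z P = Z (PolytopeO.cut P a) + Z (PolytopeO.cut P (-a))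
  map_shear : ∀ P c, c 0 = 0 → Z (PolytopeO.map P (shear (unitVec 0) c)) = Z P

namespace IsInvariant
variable {Z : PolytopeO (d + 1) → ℝ} (hZ : IsInvariant Z)
include hZ

/-- The shear y ↦ y + y₀(0, t) translates the hyperplane y₀ = 1 by t. -/
theorem box_add (a b t : Fin d → ℝ) : Z (box (a + t) (b + t)) = Z (box a b) := by
  have h0 : (WithLp.toLp 2 (Fin.cons 0 t) : E (d + 1)) 0 = 0 := rfl
  rw [← hZ.map_shear (box a b) _ h0, box, box, boxPyramid_map_shear _ _ h0]
  congr 2 <;>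
  · funext i
    refine Fin.cases ?_ (fun j => ?_) i <;> simp

theorem box_split (a b : Fin d → ℝ) (i : Fin d) {c : ℝ} (ha : a i ≤ c) (hb : c ≤ b i) :
    Z (box a b) = Z (box a (Function.update b i c)) + Z (box (Function.update a i c) b) := by
  have hne : (unitVec i.succ - c • unitVec 0 : E (d + 1)) ≠ 0 := by
    intro h
    have := congrArg (fun y : E (d + 1) => y i.succ) h
    simp at this
  rw [box, hZ.cut_add_cut _ _ hne, boxPyramid_cut (Fin.succ_ne_zero i) _ _ (by simpa using hb),
    boxPyramid_cut_neg (Fin.succ_ne_zero i) _ _ (by simpa using ha), box, box, Fin.cons_update,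
    Fin.cons_update]

/-- Cauchy's equation in one side length: split the side at x and translate the second piece back.
-/
theorem box_update_add (s : Fin d → ℝ) (i : Fin d) {x y : ℝ} (hx : 0 ≤ x) (hy : 0 ≤ y) :
    Z (box 0 (Function.update s i (x + y))) =
      Z (box 0 (Function.update s i x)) + Z (box 0 (Function.update s i y)) := by
  rw [hZ.box_split 0 (Function.update s i (x + y)) i (c := x) hx (by simpa using hy),
    Function.update_idem]
  congr 1
  rw [← hZ.box_add 0 (Function.update s i y) (Function.update 0 i x)]
  congr 2
  · simp
  · funext j
    by_cases hj : j = i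
    · subst hj; simp [add_comm]
    · simp [hj]

theorem box_update_mul (s : Fin d → ℝ) (i : Fin d) {x : ℝ} (hx : 0 ≤ x) (N : ℕ) :
    Z (box 0 (Function.update s i (N * x))) = N * Z (box 0 (Function.update s i x)) := by
  induction N with
  | zero =>
    have := hZ.box_update_add s i (le_refl (0 : ℝ)) (le_refl (0 : ℝ))
    rw [add_zero] at this
    simp only [Nat.cast_zero, zero_mul]
    linarith
  | succ N ih =>
    rw [Nat.cast_succ, add_mul, one_mul, hZ.box_update_add s i (by positivity) hx, ih]
    ring

theorem box_mul (t : ℝ) (ht : 0 ≤ t) (N : ℕ) :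
    Z (box (0 : Fin d → ℝ) (fun _ => N * t)) = N ^ d * Z (box (0 : Fin d → ℝ) (fun _ => t)) := by
  classical
  have key : ∀ S : Finset (Fin d), Z (box (0 : Fin d → ℝ) (fun i => if i ∈ S then N * t else t)) =
      N ^ S.card * Z (box (0 : Fin d → ℝ) (fun _ => t)) := by
    intro S
    induction S using Finset.induction_on with
    | empty => simp
    | insert i S hi ih =>
      have h1 : (fun j => if j ∈ insert i S then N * t else t) =
          Function.update (fun j => if j ∈ S then N * t else t) i (N * t) := by
        funext j
        by_cases hj : j = i
        · subst hj; simp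
        · simp [hj]
      have h2 : Function.update (fun j => if j ∈ S then N * t else t) i t =
          fun j => if j ∈ S then N * t else t := by
        rw [Function.update_eq_self_iff]
        simp [hi]
      rw [h1, hZ.box_update_mul _ _ ht, h2, ih, Finset.card_insert_of_notMem hi]
      ring
  have := key Finset.univ
  simpa using this

/-- Lower bound by the number of pyramids over cells of the lattice of mesh `1 / k` in `P`. -/
theorem card_mul_le {k : ℕ} (S : Finset (Fin d → ℤ)) (P : PolytopeO (d + 1))
    (hP : ∀ y ∈ P.carrier, y 0 ≤ 1)
    (hS : ∀ ν ∈ S, (box (fun i => ν i * (k : ℝ)⁻¹)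
      (fun i => (ν i + 1) * (k : ℝ)⁻¹)).carrier ⊆ P.carrier) :
    S.card * Z (box (0 : Fin d → ℝ) (fun _ => (k : ℝ)⁻¹)) ≤ Z P := by
  induction hc : S.card using Nat.strong_induction_on generalizing S P with
  | _ c ih =>
  by_cases h1 : S.card ≤ 1
  · rcases Finset.card_le_one_iff_subset_singleton.1 h1 with ⟨ν, hν⟩
    rcases Finset.subset_singleton_iff.1 hν with rfl | rfl
    · rw [← hc]
      simpa using hZ.nonneg P
    · obtain ⟨M, hM⟩ := isPyramid_boxPyramid (0 : Fin (d + 1))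
        (Fin.cons 1 fun i => ν i * (k : ℝ)⁻¹) (Fin.cons 1 fun i => (ν i + 1) * (k : ℝ)⁻¹)
      have hle := le_of_isPyramid ⊤ (fun _ => True) Z (fun _ _ _ _ => trivial)
        (fun P _ => hZ.nonneg P) (fun P _ a _ ha => hZ.cut_add_cut P a ha) hM (Q := P) trivial
        (fun y hy => ⟨Submodule.mem_top, by rw [inner_unitVec]; exact hP y hy⟩)
        (hS ν (Finset.mem_singleton_self ν))
      rw [← hc, Finset.card_singleton, Nat.cast_one, one_mul]
      refine le_of_eq_of_le ?_ hle
      rw [← hZ.box_add _ _ (fun i => ν i * (k : ℝ)⁻¹)]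
      congr 2
      · simp
      · funext i
        simp only [Pi.add_apply]
        ring
  · obtain ⟨ν, hν, ν', hν', hne⟩ := Finset.one_lt_card.1 (not_le.1 h1)
    obtain ⟨i, hi⟩ := Function.ne_iff.1 hne
    wlog hlt : ν i < ν' i generalizing ν ν'
    · exact this ν' hν' ν hν hne.symm hi.symm (lt_of_le_of_ne (not_lt.1 hlt) hi.symm)
    -- The hyperplane through the origin and the lower wall, in coordinate i, of the cell ν'. It
    -- separates the cells σ with σ i < ν' i from the others, and both classes are nonempty.
    let a : E (d + 1) := unitVec i.succ - (ν' i * (k : ℝ)⁻¹) • unitVec 0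
    have hay : ∀ y, inner ℝ a y = y i.succ - ν' i * (k : ℝ)⁻¹ * y 0 := by
      intro y
      simp only [a, inner_sub_left, inner_smul_left, inner_unitVec, conj_trivial]
    have ha : a ≠ 0 := by
      intro h
      have := congrArg (fun y : E (d + 1) => y i.succ) h
      simp [a] at this
    have hk : 0 ≤ (k : ℝ)⁻¹ := by positivity
    have hsum := Finset.card_filter_add_card_filter_not (s := S) (fun σ => σ i < ν' i)
    have hpos1 : 0 < (S.filter fun σ => σ i < ν' i).card :=
      Finset.card_pos.2 ⟨ν, Finset.mem_filter.2 ⟨hν, hlt⟩⟩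
    have hpos2 : 0 < (S.filter fun σ => ¬ σ i < ν' i).card :=
      Finset.card_pos.2 ⟨ν', Finset.mem_filter.2 ⟨hν', lt_irrefl _⟩⟩
    have e1 := ih _ (by omega) (S.filter fun σ => σ i < ν' i) (P.cut a)
      (fun y hy => hP y (P.cut_subset a hy)) (fun σ hσ y hy => ?_) rfl
    · have e2 := ih _ (by omega) (S.filter fun σ => ¬ σ i < ν' i) (P.cut (-a))
        (fun y hy => hP y (P.cut_subset (-a) hy)) (fun σ hσ y hy => ?_) rfl
      · rw [hZ.cut_add_cut P a ha, ← hc, ← hsum]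
        push_cast
        linarith
      · rw [Finset.mem_filter] at hσ
        refine PolytopeO.mem_cut.2 ⟨hS σ hσ.1 hy, ?_⟩
        rw [mem_box] at hy
        rw [inner_neg_left, hay]
        have h2 : (ν' i : ℝ) ≤ σ i := by exact_mod_cast not_lt.1 hσ.2
        have h3 := mul_le_mul_of_nonneg_right (mul_le_mul_of_nonneg_right h2 hk) hy.1.1
        have := (hy.2 i).1
        linarith
    · rw [Finset.mem_filter] at hσ
      refine PolytopeO.mem_cut.2 ⟨hS σ hσ.1 hy, ?_⟩
      rw [mem_box] at hy
      rw [hay]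
      have h2 : (σ i : ℝ) + 1 ≤ ν' i := by exact_mod_cast hσ.2
      have h3 := mul_le_mul_of_nonneg_right (mul_le_mul_of_nonneg_right h2 hk) hy.1.1
      have := (hy.2 i).2
      linarith

-- Counting lattice points: for large k, each point of (1/k)ℤᵈ in the shrunken base spans a cell
-- contained in the base, the number of these points is asymptotic to kᵈ times the volume of the
-- shrunken base, and each cell contributes k⁻ᵈ times the value of the unit box.
open scoped Pointwise in
theorem mul_baseVol_homothety_le {P : PolytopeO (d + 1)} (hP : ∀ y ∈ P.carrier, y 0 ≤ 1)
    {z₀ : Fin d → ℝ} (hz₀ : z₀ ∈ interior (base P)) {ε : ℝ} (hε : 0 < ε) (hε1 : ε < 1) :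
    Z (box (0 : Fin d → ℝ) (fun _ => 1)) * ((1 - ε) ^ d * baseVol P) ≤ Z P := by
  set S : Set (Fin d → ℝ) := AffineMap.homothety z₀ (1 - ε) '' base P with hS
  have hcont : Continuous (AffineMap.homothety z₀ (1 - ε) : (Fin d → ℝ) →ᵃ[ℝ] (Fin d → ℝ)) :=
    AffineMap.homothety_continuous _ _
  have hcomp : IsCompact S :=
    (Metric.isCompact_of_isClosed_isBounded (isClosed_base P) (isBounded_base P)).image hcont
  have hconv : Convex ℝ S := (convex_base P).affine_image _
  have hvol : volume.real S = (1 - ε) ^ d * baseVol P := by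
    rw [hS, measureReal_def, Measure.addHaar_image_homothety, ENNReal.toReal_mul,
      ENNReal.toReal_ofReal (abs_nonneg _), Module.finrank_fin_fun, abs_of_nonneg (by
        have : 0 ≤ 1 - ε := by linarith
        positivity)]
    rfl
  have hlim := tendsto_card_div_pow_atTop_volume S hcomp.isBounded hcomp.isClosed.measurableSet
    (hconv.addHaar_frontier volume)
  rw [hvol] at hlim
  refine le_of_tendsto (hlim.const_mul _) ?_
  obtain ⟨δ, hδ, hball⟩ := Metric.mem_nhds_iff.1 (mem_interior_iff_mem_nhds.1 hz₀)
  obtain ⟨K, hK⟩ := exists_nat_gt (ε * δ)⁻¹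
  filter_upwards [Filter.eventually_ge_atTop (K + 1)] with k hk
  have hk0 : (0 : ℝ) < k := by exact_mod_cast (Nat.succ_pos K).trans_le hk
  have hkε : (k : ℝ)⁻¹ < ε * δ := by
    rw [inv_lt_comm₀ hk0 (by positivity)]
    refine hK.trans_le ?_
    exact_mod_cast (Nat.le_succ K).trans hk
  let e : (Fin d → ℤ) → (Fin d → ℝ) := fun ν i => ν i * (k : ℝ)⁻¹
  have he : Function.Injective e := by
    intro ν ν' h
    funext i
    have := congrFun h i
    simp only [e] at this
    exact_mod_cast mul_right_cancel₀ (inv_ne_zero hk0.ne') this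
  have hset : S ∩ (k : ℝ)⁻¹ • (Submodule.span ℤ (Set.range (Pi.basisFun ℝ (Fin d))) :
      Set (Fin d → ℝ)) = e '' {ν | e ν ∈ S} := by
    ext z
    simp only [Set.mem_inter_iff, Set.mem_image, Set.mem_smul_set, SetLike.mem_coe]
    constructor
    · rintro ⟨hz, v, hv, rfl⟩
      rw [(Pi.basisFun ℝ (Fin d)).mem_span_iff_repr_mem ℤ] at hv
      choose ν hν using hv
      have : e ν = (k : ℝ)⁻¹ • v := by
        funext i
        have := hν i
        simp only [Pi.basisFun_repr, eq_intCast] at this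
        simp only [e, Pi.smul_apply, smul_eq_mul, this, mul_comm]
      exact ⟨ν, by show e ν ∈ S; rwa [this], this⟩
    · rintro ⟨ν, hν, rfl⟩
      refine ⟨hν, fun i => ν i, ?_, ?_⟩
      · rw [(Pi.basisFun ℝ (Fin d)).mem_span_iff_repr_mem ℤ]
        intro i
        exact ⟨ν i, by simp⟩
      · funext i
        simp [e, mul_comm]
  rw [hset, Nat.card_coe_set_eq, Set.ncard_image_of_injective _ he, Fintype.card_fin]
  have hq : Z (box (0 : Fin d → ℝ) (fun _ => 1)) =
      (k : ℝ) ^ d * Z (box (0 : Fin d → ℝ) (fun _ => (k : ℝ)⁻¹)) := by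
    rw [← hZ.box_mul _ (by positivity)]
    simp only [mul_inv_cancel₀ hk0.ne']
  rw [hq]
  have hfin : Z (box (0 : Fin d → ℝ) (fun _ => (k : ℝ)⁻¹)) * ({ν | e ν ∈ S} : Set _).ncard ≤ Z P := by
    by_cases hf : ({ν | e ν ∈ S} : Set (Fin d → ℤ)).Finite
    · rw [Set.ncard_eq_toFinset_card _ hf, mul_comm]
      refine hZ.card_mul_le _ P hP fun ν hν y hy => ?_
      have hν' : e ν ∈ S := by simpa using hν
      obtain ⟨f, hf, hfe⟩ := hν'
      rw [mem_box] at hy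
      rcases hy.1.1.eq_or_lt with h0 | h0
      · have : y = 0 := by
          ext i
          refine Fin.cases h0.symm (fun j => ?_) i
          have := hy.2 j
          rw [← h0, mul_zero, mul_zero] at this
          exact le_antisymm this.2 this.1
        rw [this]
        exact P.zero_mem
      · let z : Fin d → ℝ := fun i => y i.succ / y 0
        have hyz : y = y 0 • lift z := by
          ext i
          refine Fin.cases (by simp) (fun j => ?_) i
          simp only [PiLp.smul_apply, lift_succ, smul_eq_mul, z]
          rw [mul_div_cancel₀ _ h0.ne']
        have hz : z ∈ base P := by
          -- With e ν = (1 - ε)f + εz₀, a point z of the cell equals (1 - ε)f + εr. As 1/k < εδ, r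
          -- stays in the ball of radius δ about z₀, which lies in the base.
          let r : Fin d → ℝ := fun i => z₀ i + ε⁻¹ * (z i - e ν i)
          have hr : r ∈ base P := by
            apply hball
            rw [mem_ball_iff_norm, pi_norm_lt_iff hδ]
            intro i
            have h1 := hy.2 i
            have h2 : e ν i ≤ z i := by
              simp only [e, z]
              rw [le_div_iff₀ h0]
              exact h1.1
            have h3 : z i ≤ e ν i + (k : ℝ)⁻¹ := by
              simp only [e, z]
              rw [div_le_iff₀ h0]
              linarith [h1.2]
            simp only [Pi.sub_apply, r, add_sub_cancel_left, Real.norm_eq_abs]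
            rw [abs_of_nonneg (mul_nonneg (by positivity) (by linarith)), inv_mul_lt_iff₀ hε]
            linarith
          have hcomb : z = (1 - ε) • f + ε • r := by
            funext i
            have := congrFun hfe i
            simp only [AffineMap.homothety_apply, vsub_eq_sub, vadd_eq_add, Pi.add_apply,
              Pi.smul_apply, Pi.sub_apply, smul_eq_mul] at this
            simp only [Pi.add_apply, Pi.smul_apply, smul_eq_mul, r, ← this]
            field_simp
            ring
          rw [hcomb]
          exact convex_base P hf hr (by linarith) hε.le (by ring)
        rw [hyz]
        exact P.convex.smul_mem_of_zero_mem P.zero_mem hz ⟨h0.le, hy.1.2⟩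
    -- `ncard` of an infinite set is 0, so this case is harmless.
    · rw [Set.Infinite.ncard hf]
      simpa using hZ.nonneg P
  have hkd : (0 : ℝ) < (k : ℝ) ^ d := by positivity
  calc _ = Z (box (0 : Fin d → ℝ) (fun _ => (k : ℝ)⁻¹)) * ({ν | e ν ∈ S} : Set _).ncard := by
        field_simp
    _ ≤ _ := hfin

/-- Let ε → 0. A base without interior equals its frontier, which is null by convexity. -/
theorem mul_baseVol_le {P : PolytopeO (d + 1)} (hP : ∀ y ∈ P.carrier, y 0 ≤ 1) :
    Z (box (0 : Fin d → ℝ) (fun _ => 1)) * baseVol P ≤ Z P := by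
  rcases (interior (base P)).eq_empty_or_nonempty with h | ⟨z₀, hz₀⟩
  · have h1 : volume (base P) = 0 := by
      have := (convex_base P).addHaar_frontier volume
      rwa [(isClosed_base P).frontier_eq, h, Set.sdiff_empty] at this
    rw [baseVol, measureReal_def, h1]
    simpa using hZ.nonneg P
  · have hlim : Filter.Tendsto (fun ε : ℝ => Z (box (0 : Fin d → ℝ) (fun _ => 1)) *
        ((1 - ε) ^ d * baseVol P)) (nhdsWithin 0 (Set.Ioi 0))
        (nhds (Z (box (0 : Fin d → ℝ) (fun _ => 1)) * ((1 - 0) ^ d * baseVol P))) := by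
      apply Filter.Tendsto.mono_left _ nhdsWithin_le_nhds
      apply Continuous.tendsto
      fun_prop
    rw [sub_zero, one_pow, one_mul] at hlim
    refine le_of_tendsto hlim ?_
    filter_upwards [Ioo_mem_nhdsGT (zero_lt_one (α := ℝ))] with ε hε
    exact hZ.mul_baseVol_homothety_le hP hz₀ hε.1 hε.2

/-- Invariant functions are multiples of the volume of the base. -/
theorem eq_mul_baseVol {P : PolytopeO (d + 1)} {M : Finset (E (d + 1))}
    (hP : IsPyramid ⊤ (unitVec 0) M P) :
    Z P = Z (box (0 : Fin d → ℝ) (fun _ => 1)) * baseVol P := by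
  classical
  have hP1 : ∀ y ∈ P.carrier, y 0 ≤ 1 := fun y hy => by
    have := (hP.mem_iff.1 hy).2.1
    rwa [inner_unitVec] at this
  refine le_antisymm ?_ (hZ.mul_baseVol_le hP1)
  -- The upper bound passes from Q to Q.cut a: subtract the lower bound for Q.cut (-a). The start is
  -- a large box pyramid around P, where equality holds.
  have key : ∀ M : Finset (E (d + 1)), ∀ Q : PolytopeO (d + 1), (∀ y ∈ Q.carrier, y 0 ≤ 1) →
      Z Q ≤ Z (box (0 : Fin d → ℝ) (fun _ => 1)) * baseVol Q → ∀ P : PolytopeO (d + 1),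
      P.carrier = {y | y ∈ Q.carrier ∧ ∀ m ∈ M, inner ℝ m y ≤ 0} →
      Z P ≤ Z (box (0 : Fin d → ℝ) (fun _ => 1)) * baseVol P := by
    intro M
    induction M using Finset.induction_on with
    | empty =>
      intro Q _ hQ P hP
      have : P = Q := PolytopeO.ext (by rw [hP]; simp)
      rwa [this]
    | insert a M _ ih =>
      intro Q hQ1 hQ P hP
      refine ih (Q.cut a) (fun y hy => hQ1 y (Q.cut_subset a hy)) ?_ P ?_
      · by_cases ha : a = 0
        · have : Q.cut a = Q := PolytopeO.ext (by ext y; simp [PolytopeO.mem_cut, ha])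
          rwa [this]
        · rw [hZ.cut_add_cut Q a ha] at hQ
          have h1 := hZ.mul_baseVol_le (P := Q.cut (-a)) fun y hy => hQ1 y (Q.cut_subset _ hy)
          have h2 := mul_le_mul_of_nonneg_left (baseVol_le_add Q a)
            (hZ.nonneg (box (0 : Fin d → ℝ) (fun _ => 1)))
          linarith
      · rw [hP]
        ext y
        simp only [Set.mem_ofPred_eq, PolytopeO.mem_cut, Finset.forall_mem_insert, and_assoc]
  obtain ⟨R, hR0, hR⟩ := hP.exists_bound LinearMap.id
  refine key M (box (fun _ => -(R : ℝ)) (fun _ => (R : ℝ))) (fun y hy => (mem_box.1 hy).1.2) ?_ P ?_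
  · apply le_of_eq
    rw [baseVol, base_box, measureReal_def, Real.volume_Icc_pi,
      ← hZ.box_add _ _ (fun _ => (R : ℝ))]
    have h1 : (fun _ => -(R : ℝ)) + (fun _ => (R : ℝ)) = (0 : Fin d → ℝ) := by funext i; simp
    have h2 : (fun _ => (R : ℝ)) + (fun _ => (R : ℝ)) =
        (fun _ : Fin d => ((2 * R : ℕ) : ℝ) * 1) := by
      funext i; simp; ring
    rw [h1, h2, hZ.box_mul _ zero_le_one, Finset.prod_const, Finset.card_univ, Fintype.card_fin,
      ENNReal.toReal_pow, ENNReal.toReal_ofReal (by simp), mul_comm]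
    congr 2
    push_cast
    ring
  · ext y
    rw [hP.mem_iff, Set.mem_ofPred_eq, mem_box]
    constructor
    · intro h
      have hy := hP.mem_iff.2 h
      have hb : ∀ i, |y i| ≤ R * y 0 := fun i => by
        have := hR y hy i
        rwa [inner_unitVec] at this
      refine ⟨⟨⟨?_, hP1 y hy⟩, fun i => ?_⟩, h.2.2⟩
      · exact nonneg_of_mul_nonneg_right ((abs_nonneg _).trans (hb 0)) (Nat.cast_pos.2 hR0)
      · have := abs_le.1 (hb i.succ)
        rwa [neg_mul]
    · rintro ⟨h1, h2⟩
      exact ⟨Submodule.mem_top, by rw [inner_unitVec]; exact h1.1.2, h2⟩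

end IsInvariant
end Base

end

section

/-! ### Uniqueness of mass functions -/

namespace IsMassFunction
variable {m : ℕ} {p : ℝ} {w w' : PolytopeO (m + 3) → E (m + 3) → ℝ}

/-- The adjoint of the shear by t moves e₀ by a multiple of ⟨t, e₀⟩ = 0. -/
theorem isInvariant (hw : IsMassFunction p w) (hp : p ≠ 1) {c : ℝ} (hc : c ≠ 0) :
    IsInvariant (d := m + 2) fun P => w P (c • unitVec 0) where
  nonneg P := hw.nonneg P _
  cut_add_cut P a ha := hw.cut_add_cut hp P ha (smul_ne_zero hc (unitVec_ne_zero 0))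
  map_shear P t ht := by
    rw [hw.map_shear _ _ (smul_ne_zero hc (unitVec_ne_zero 0)), inner_smul_right,
      real_inner_comm, inner_unitVec, ht, mul_zero, zero_smul, add_zero]
    rw [inner_unitVec, ht]

/-- Mass functions are determined by two values. -/
theorem eq_of_box_eq (hw : IsMassFunction p w) (hw' : IsMassFunction p w') (hp : p ≠ 1)
    (h1 : w (box (0 : Fin (m + 2) → ℝ) (fun _ => 1)) (unitVec 0) =
      w' (box (0 : Fin (m + 2) → ℝ) (fun _ => 1)) (unitVec 0))
    (h2 : w (box (0 : Fin (m + 2) → ℝ) (fun _ => 1)) (-unitVec 0) =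
      w' (box (0 : Fin (m + 2) → ℝ) (fun _ => 1)) (-unitVec 0))
    (P : PolytopeO (m + 3)) {x : E (m + 3)} (hx : x ≠ 0) : w P x = w' P x := by
  classical
  have hbox : ∀ c : ℝ, c ≠ 0 → w (box (0 : Fin (m + 2) → ℝ) (fun _ => 1)) (c • unitVec 0) =
      w' (box (0 : Fin (m + 2) → ℝ) (fun _ => 1)) (c • unitVec 0) := by
    intro c hc
    rcases lt_or_gt_of_ne hc with h | h
    · have : c • (unitVec 0 : E (m + 3)) = (-c) • -unitVec 0 := by rw [smul_neg, neg_smul, neg_neg]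
      rw [this, hw.smul _ _ _ (neg_pos.2 h) (neg_ne_zero.2 (unitVec_ne_zero 0)),
        hw'.smul _ _ _ (neg_pos.2 h) (neg_ne_zero.2 (unitVec_ne_zero 0)), h2]
    · rw [hw.smul _ _ _ h (unitVec_ne_zero 0), hw'.smul _ _ _ h (unitVec_ne_zero 0), h1]
  rw [← sub_eq_zero]
  refine eq_zero_of_pyramid ⊤ (fun P => w P x - w' P x) (fun P _ a _ ha => ?_) ?_ P
    (Set.subset_univ _)
  · rw [hw.cut_add_cut hp P ha hx, hw'.cut_add_cut hp P ha hx]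
    ring
  · intro P ℓ M _ hPyr
    by_cases hℓ : ℓ = 0
    · have h0 : P.carrier ⊆ {0} := by
        intro y hy
        by_contra hy0
        have := hPyr.inner_pos hy hy0
        rw [hℓ, inner_zero_left] at this
        exact this.false
      rw [hw.eq_zero_of_eq_singleton h0 hx, hw'.eq_zero_of_eq_singleton h0 hx, sub_zero]
    rcases linearIndependent_or_eq_smul (x := x) hℓ with h | ⟨c, rfl⟩
    · rw [LinearIndependent.pair_symm_iff] at h
      rw [hw.eq_zero_of_isPyramid hp hPyr h, hw'.eq_zero_of_isPyramid hp hPyr h, sub_zero]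
    · have hc : c ≠ 0 := fun h => hx (by rw [h, zero_smul])
      obtain ⟨v, hv⟩ := exists_linearIndependent_pair_of_one_lt_finrank (R := ℝ)
        (by rw [finrank_euclideanSpace_fin]; omega) hℓ
      obtain ⟨A, hA, -, h0, -⟩ := exists_det_eq_one_adjoint hv
      have hx0 : c • (unitVec 0 : E (m + 3)) ≠ 0 := smul_ne_zero hc (unitVec_ne_zero 0)
      have e1 := hw.map _ hA P _ hx0
      have e2 := hw'.map _ hA P _ hx0
      rw [map_smul, h0] at e1 e2
      -- The adjoint of A sends e₀ to ℓ, so the image of P has its base in {y₀ = 1} and the volume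
      -- formula applies.
      have hPyr' : IsPyramid ⊤ (unitVec 0)
          (M.image (LinearMap.adjoint (A.symm : E (m + 3) →ₗ[ℝ] E (m + 3))))
          (P.map (A : E (m + 3) →ₗ[ℝ] E (m + 3))) := by
        refine ⟨Set.subset_univ _, ?_⟩
        ext y
        rw [PolytopeO.mem_map_equiv, hPyr.mem_iff, Set.mem_ofPred_eq]
        simp only [Finset.forall_mem_image, LinearMap.adjoint_inner_left, Submodule.mem_top,
          true_and, LinearEquiv.coe_coe]
        rw [← h0, LinearMap.adjoint_inner_left]
        simp
      have i1 := (hw.isInvariant hp hc).eq_mul_baseVol hPyr'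
      have i2 := (hw'.isInvariant hp hc).eq_mul_baseVol hPyr'
      rw [← e1, ← e2, i1, i2, hbox c hc, sub_self]

end IsMassFunction

end

section

/-! ### Support functions and faces -/

variable {n : ℕ}

theorem PolytopeO.isGreatest_supportFn (P : PolytopeO n) (x : E n) :
    IsGreatest ((fun y => (inner ℝ x y : ℝ)) '' P.carrier) (supportFn P.carrier x) :=
  (P.isCompact.image (by fun_prop)).isGreatest_sSup ⟨_, 0, P.zero_mem, rfl⟩

theorem PolytopeO.inner_le_supportFn (P : PolytopeO n) {x y : E n} (hy : y ∈ P.carrier) :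
    inner ℝ x y ≤ supportFn P.carrier x :=
  (P.isGreatest_supportFn x).2 ⟨y, hy, rfl⟩

theorem PolytopeO.supportFn_nonneg (P : PolytopeO n) (x : E n) : 0 ≤ supportFn P.carrier x := by
  have := P.inner_le_supportFn (x := x) P.zero_mem
  rwa [inner_zero_right] at this

theorem PolytopeO.face_nonempty (P : PolytopeO n) (x : E n) : (face P.carrier x).Nonempty := by
  obtain ⟨y, hy, h⟩ := (P.isGreatest_supportFn x).1
  exact ⟨y, hy, h⟩

theorem PolytopeO.isCompact_face (P : PolytopeO n) (x : E n) : IsCompact (face P.carrier x) :=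
  P.isCompact.inter_right (isClosed_eq (f := fun y : E n => (inner ℝ x y : ℝ)) (by fun_prop)
    continuous_const)

theorem PolytopeO.convex_face (P : PolytopeO n) (x : E n) : Convex ℝ (face P.carrier x) := by
  intro y hy z hz a b ha hb hab
  refine ⟨P.convex hy.1 hz.1 ha hb hab, ?_⟩
  rw [inner_add_right, inner_smul_right, inner_smul_right, hy.2, hz.2, ← add_mul, hab, one_mul]

theorem PolytopeO.supportFn_eq (P : PolytopeO n) {x : E n} {h : ℝ}
    (hle : ∀ y ∈ P.carrier, inner ℝ x y ≤ h) {y : E n} (hy : y ∈ P.carrier)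
    (hyh : inner ℝ x y = h) : supportFn P.carrier x = h := by
  refine le_antisymm ?_ (hyh ▸ P.inner_le_supportFn hy)
  obtain ⟨z, hz, hz'⟩ := (P.isGreatest_supportFn x).1
  rw [← hz']
  exact hle z hz

theorem PolytopeO.supportFn_map (P : PolytopeO n) (L : E n →ₗ[ℝ] E n) (x : E n) :
    supportFn (P.map L).carrier x = supportFn P.carrier (LinearMap.adjoint L x) := by
  obtain ⟨y, hy, hyh⟩ := P.face_nonempty (LinearMap.adjoint L x)
  refine (P.map L).supportFn_eq ?_ (y := L y) ⟨y, hy, rfl⟩ ?_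
  · rintro _ ⟨z, hz, rfl⟩
    rw [← LinearMap.adjoint_inner_left]
    exact P.inner_le_supportFn hz
  · rw [← LinearMap.adjoint_inner_left, hyh]

theorem PolytopeO.face_map (P : PolytopeO n) (L : E n →ₗ[ℝ] E n) (x : E n) :
    face (P.map L).carrier x = L '' face P.carrier (LinearMap.adjoint L x) := by
  ext y
  constructor
  · rintro ⟨⟨z, hz, rfl⟩, h⟩
    refine ⟨z, ⟨hz, ?_⟩, rfl⟩
    rw [LinearMap.adjoint_inner_left, h, P.supportFn_map]
  · rintro ⟨z, ⟨hz, h⟩, rfl⟩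
    refine ⟨⟨z, hz, rfl⟩, ?_⟩
    rw [← LinearMap.adjoint_inner_left, h, P.supportFn_map]

theorem PolytopeO.supportFn_smul (P : PolytopeO n) (x : E n) {t : ℝ} (ht : 0 ≤ t) :
    supportFn P.carrier (t • x) = t * supportFn P.carrier x := by
  obtain ⟨y, hy, hyh⟩ := P.face_nonempty x
  refine P.supportFn_eq (fun z hz => ?_) hy ?_
  · rw [inner_smul_left, conj_trivial]
    exact mul_le_mul_of_nonneg_left (P.inner_le_supportFn hz) ht
  · rw [inner_smul_left, conj_trivial, hyh]

theorem PolytopeO.face_smul (P : PolytopeO n) (x : E n) {t : ℝ} (ht : 0 < t) :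
    face P.carrier (t • x) = face P.carrier x := by
  ext y
  simp only [face, Set.mem_ofPred_eq, P.supportFn_smul x ht.le, inner_smul_left, conj_trivial,
    mul_right_inj' ht.ne']

/-! ### Volumes of cylinders -/

/-- The cylinder with base `F` and generating vector `v`. -/
def cylinder (F : Set (E n)) (v : E n) : Set (E n) :=
  (fun q : E n × ℝ => q.1 + q.2 • v) '' F ×ˢ Set.Icc 0 1

theorem isCompact_cylinder {F : Set (E n)} (hF : IsCompact F) (v : E n) :
    IsCompact (cylinder F v) :=
  (hF.prod isCompact_Icc).image (by fun_prop)

theorem image_cylinder (L : E n →ₗ[ℝ] E n) (F : Set (E n)) (v : E n) :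
    L '' cylinder F v = cylinder (L '' F) (L v) := by
  ext y
  simp only [cylinder, Set.mem_image, Set.mem_prod, Prod.exists]
  constructor
  · rintro ⟨_, ⟨a, s, ⟨ha, hs⟩, rfl⟩, rfl⟩
    exact ⟨L a, s, ⟨⟨a, ha, rfl⟩, hs⟩, by simp⟩
  · rintro ⟨_, s, ⟨⟨a, ha, rfl⟩, hs⟩, rfl⟩
    exact ⟨_, ⟨a, s, ⟨ha, hs⟩, rfl⟩, by simp⟩

/-- Slice orthogonally to x. The slice through t • x is a translate of F for t in an interval of
length c/‖x‖² and empty otherwise; integration in t carries a factor ‖x‖. -/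
theorem volume_cylinder {F : Set (E n)} (hF : IsCompact F) {x v : E n} {h c : ℝ} (hx : x ≠ 0)
    (hFx : ∀ y ∈ F, inner ℝ x y = h) (hv : inner ℝ x v = c) (hc : 0 < c) :
    volume (cylinder F v) = ENNReal.ofReal (c / ‖x‖) * μHE[n - 1] F := by
  have hxn : 0 < ‖x‖ := norm_pos_iff.2 hx
  have hslice : ∀ t : ℝ, μHE[n - 1] (cylinder F v ∩
      AffineSubspace.mk' (t • x +ᵥ (0 : E n)) (ℝ ∙ x)ᗮ) =
      (Set.Icc (h / ‖x‖ ^ 2) ((h + c) / ‖x‖ ^ 2)).indicator (fun _ => μHE[n - 1] F) t := by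
    intro t
    have hmem : ∀ y : E n, y ∈ AffineSubspace.mk' (t • x +ᵥ (0 : E n)) (ℝ ∙ x)ᗮ ↔
        inner ℝ x y = t * ‖x‖ ^ 2 := by
      intro y
      rw [AffineSubspace.mem_mk', Submodule.mem_orthogonal_singleton_iff_inner_right, vadd_eq_add,
        add_zero, vsub_eq_sub, inner_sub_right, inner_smul_right, real_inner_self_eq_norm_sq,
        sub_eq_zero]
    have hin : ∀ a ∈ F, ∀ s : ℝ, inner ℝ x (a + s • v) = h + s * c := by
      intro a ha s
      rw [inner_add_right, inner_smul_right, hFx a ha, hv]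
    by_cases ht : t ∈ Set.Icc (h / ‖x‖ ^ 2) ((h + c) / ‖x‖ ^ 2)
    · rw [Set.indicator_of_mem ht]
      rw [Set.mem_Icc, div_le_iff₀ (by positivity), le_div_iff₀ (by positivity)] at ht
      have : cylinder F v ∩ AffineSubspace.mk' (t • x +ᵥ (0 : E n)) (ℝ ∙ x)ᗮ =
          (fun y => ((t * ‖x‖ ^ 2 - h) / c) • v + y) '' F := by
        ext y
        rw [Set.mem_inter_iff, SetLike.mem_coe, hmem]
        constructor
        · rintro ⟨⟨⟨a, s⟩, ⟨ha, hs⟩, rfl⟩, hy⟩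
          rw [hin a ha] at hy
          refine ⟨a, ha, ?_⟩
          have : (t * ‖x‖ ^ 2 - h) / c = s := by
            rw [div_eq_iff hc.ne']
            linarith
          simp only [this, add_comm]
        · rintro ⟨a, ha, rfl⟩
          refine ⟨⟨(a, (t * ‖x‖ ^ 2 - h) / c), ⟨ha, ?_, ?_⟩, ?_⟩, ?_⟩
          · exact div_nonneg (by linarith) hc.le
          · show (t * ‖x‖ ^ 2 - h) / c ≤ 1
            rw [div_le_one hc]
            linarith
          · simp only [add_comm]
          · simp only
            rw [add_comm, hin a ha, div_mul_cancel₀ _ hc.ne']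
            ring
      rw [this]
      exact (isometry_add_left _).euclideanHausdorffMeasure_image F
    · rw [Set.indicator_of_notMem ht]
      have : cylinder F v ∩ AffineSubspace.mk' (t • x +ᵥ (0 : E n)) (ℝ ∙ x)ᗮ = ∅ := by
        rw [Set.eq_empty_iff_forall_notMem]
        rintro y ⟨⟨⟨a, s⟩, ⟨ha, hs⟩, rfl⟩, hy⟩
        rw [SetLike.mem_coe, hmem, hin a ha] at hy
        apply ht
        have h1 := mul_nonneg hs.1 hc.le
        have h2 := mul_le_of_le_one_left hc.le hs.2
        rw [Set.mem_Icc, div_le_iff₀ (by positivity), le_div_iff₀ (by positivity)]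
        constructor <;> linarith
      rw [this, measure_empty]
  have key := EuclideanGeometry.euclideanHausdorffMeasure_eq_lintegral (0 : E n) hx
    (isCompact_cylinder hF v).measurableSet
  rw [InnerProductSpace.euclideanHausdorffMeasure_eq_volume, finrank_euclideanSpace_fin] at key
  rw [key]
  simp_rw [hslice]
  rw [lintegral_indicator_const measurableSet_Icc, Real.volume_Icc, ← ofReal_norm,
    mul_comm (μHE[n - 1] F), ← mul_assoc, ← ENNReal.ofReal_mul hxn.le]
  congr 2
  field_simp
  ring

/-- The cylinder over F along x is compact, so it has finite volume. -/
theorem euclideanHausdorffMeasure_lt_top {F : Set (E n)} (hF : IsCompact F) {x : E n} {h : ℝ}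
    (hx : x ≠ 0) (hFx : ∀ y ∈ F, inner ℝ x y = h) : μHE[n - 1] F < ⊤ := by
  have hpos : 0 < (inner ℝ x x : ℝ) := real_inner_self_pos.2 hx
  have h1 := volume_cylinder hF hx hFx rfl hpos
  have h2 := (isCompact_cylinder hF x).measure_lt_top (μ := volume)
  rw [h1] at h2
  refine lt_top_iff_ne_top.2 fun h3 => ?_
  rw [h3, ENNReal.mul_top] at h2
  · exact h2.ne rfl
  · rw [Ne, ENNReal.ofReal_eq_zero, not_le]
    exact div_pos hpos (norm_pos_iff.2 hx)

/-- L preserves the volume of the cylinder over F along L*x, and ⟨x, L(L*x)⟩ = ⟨L*x, L*x⟩, so the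
two cylinder formulas share the constant c, which cancels. -/
theorem euclideanHausdorffMeasure_image_of_det_eq_one {L : E n →ₗ[ℝ] E n}
    (hL : LinearMap.det L = 1) {F : Set (E n)} (hF : IsCompact F) {x : E n} {h : ℝ} (hx : x ≠ 0)
    (hFx : ∀ y ∈ F, inner ℝ (LinearMap.adjoint L x) y = h) :
    ENNReal.ofReal (‖x‖⁻¹) * μHE[n - 1] (L '' F) =
      ENNReal.ofReal (‖LinearMap.adjoint L x‖⁻¹) * μHE[n - 1] F := by
  set x' := LinearMap.adjoint L x with hx'
  have hx0 : x' ≠ 0 := by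
    intro h0
    have hdet : LinearMap.det (LinearMap.adjoint L) ≠ 0 := by
      rw [det_adjoint, hL]; exact one_ne_zero
    have hker := LinearMap.ker_eq_bot.1 ((LinearMap.isUnit_iff_ker_eq_bot _).1
      ((LinearMap.isUnit_iff_isUnit_det _).2 hdet.isUnit))
    exact hx (hker (by rw [← hx', h0, map_zero]))
  have hpos : 0 < (inner ℝ x' x' : ℝ) := real_inner_self_pos.2 hx0
  have h1 := volume_cylinder hF hx0 hFx rfl hpos
  have h2 := volume_cylinder (F := L '' F) (v := L x') (x := x) (h := h)
    (hF.image L.continuous_of_finiteDimensional) hx ?_ (c := inner ℝ x' x') ?_ hpos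
  · rw [← image_cylinder, Measure.addHaar_image_linearMap, hL, abs_one, ENNReal.ofReal_one, one_mul,
      h1, div_eq_mul_inv, div_eq_mul_inv, ENNReal.ofReal_mul hpos.le, ENNReal.ofReal_mul hpos.le,
      mul_assoc, mul_assoc] at h2
    refine ((ENNReal.mul_right_inj ?_ ENNReal.ofReal_ne_top).1 h2).symm
    rwa [Ne, ENNReal.ofReal_eq_zero, not_le]
  · rintro _ ⟨y, hy, rfl⟩
    rw [← LinearMap.adjoint_inner_left]
    exact hFx y hy
  · rw [← LinearMap.adjoint_inner_left]

theorem euclideanHausdorffMeasure_eq_zero_of_finrank_lt {F : Set (E n)} {d : ℕ}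
    (h : Module.finrank ℝ (vectorSpan ℝ F) < d) : μHE[d] F = 0 := by
  rcases F.eq_empty_or_nonempty with rfl | ⟨y, hy⟩
  · exact measure_empty
  · let S : Set (vectorSpan ℝ F) := {z | y + z ∈ F}
    have hS : F = (fun z : vectorSpan ℝ F => y + (z : E n)) '' S := by
      ext a
      constructor
      · intro ha
        refine ⟨⟨a - y, vsub_mem_vectorSpan ℝ ha hy⟩, ?_, ?_⟩
        · show y + (a - y) ∈ F
          rwa [add_sub_cancel]
        · simp
      · rintro ⟨z, hz, rfl⟩
        exact hz
    have hiso : Isometry fun z : vectorSpan ℝ F => y + (z : E n) :=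
      (isometry_add_left y).comp isometry_subtype_coe
    conv_lhs => rw [hS]
    have h0 : (μH[(d : ℝ)] : Measure (vectorSpan ℝ F)) = 0 :=
      Real.hausdorffMeasure_of_finrank_lt (by exact_mod_cast h)
    rw [hiso.euclideanHausdorffMeasure_image, Measure.euclideanHausdorffMeasure_def,
      Measure.smul_apply, h0]
    simp

end

section

/-! ### The atoms of the `L_p` surface area measure -/

variable {n : ℕ} {p : ℝ}

open Classical in
/-- The mass function of the `L_p` surface area measure. -/
def surfaceMass (p : ℝ) (P : PolytopeO n) (x : E n) : ℝ :=
  if 0 < supportFn P.carrier x then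
    supportFn P.carrier x ^ (1 - p) * (‖x‖⁻¹ * (μHE[n - 1] (face P.carrier x)).toReal) else 0

theorem surfaceMass_nonneg (P : PolytopeO n) (x : E n) : 0 ≤ surfaceMass p P x := by
  rw [surfaceMass]
  split_ifs with h
  · have := Real.rpow_nonneg h.le (1 - p)
    positivity
  · exact le_rfl

/-- The support function contributes degree 1 - p, the factor ‖x‖⁻¹ degree -1, and the face does not
change. -/
theorem surfaceMass_smul (P : PolytopeO n) (x : E n) (t : ℝ) (ht : 0 < t) :
    surfaceMass p P (t • x) = t ^ (-p) * surfaceMass p P x := by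
  rw [surfaceMass, surfaceMass, P.supportFn_smul x ht.le, P.face_smul x ht, mul_ite, mul_zero]
  simp only [mul_pos_iff_of_pos_left ht]
  split_ifs with h
  · rw [Real.mul_rpow ht.le h.le, norm_smul, Real.norm_of_nonneg ht.le, mul_inv, sub_eq_add_neg,
      Real.rpow_add ht, Real.rpow_one]
    field_simp
  · rfl

theorem PolytopeO.face_lt_top (P : PolytopeO n) {x : E n} (hx : x ≠ 0) :
    μHE[n - 1] (face P.carrier x) < ⊤ :=
  euclideanHausdorffMeasure_lt_top (P.isCompact_face x) hx fun _ hy => hy.2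

theorem surfaceMass_map {L : E n →ₗ[ℝ] E n} (hL : LinearMap.det L = 1) (P : PolytopeO n) {x : E n}
    (hx : x ≠ 0) : surfaceMass p (P.map L) x = surfaceMass p P (LinearMap.adjoint L x) := by
  have h := congrArg ENNReal.toReal (euclideanHausdorffMeasure_image_of_det_eq_one hL
    (P.isCompact_face (LinearMap.adjoint L x)) hx fun _ hy => hy.2)
  rw [ENNReal.toReal_mul, ENNReal.toReal_mul, ENNReal.toReal_ofReal (by positivity),
    ENNReal.toReal_ofReal (by positivity)] at h
  rw [surfaceMass, surfaceMass, P.supportFn_map, P.face_map, h]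

theorem adjoint_neg_id (x : E n) :
    LinearMap.adjoint (-LinearMap.id : E n →ₗ[ℝ] E n) x = -x := by
  refine ext_inner_right ℝ fun y => ?_
  rw [LinearMap.adjoint_inner_left]
  simp

theorem neg_eq_map (P : PolytopeO n) : -P = P.map (-LinearMap.id) := rfl

theorem supportFn_neg (P : PolytopeO n) (x : E n) :
    supportFn (-P).carrier x = supportFn P.carrier (-x) := by
  rw [neg_eq_map, P.supportFn_map, adjoint_neg_id]

theorem surfaceMass_neg (P : PolytopeO n) (x : E n) :
    surfaceMass p (-P) x = surfaceMass p P (-x) := by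
  have hiso : Isometry (-LinearMap.id : E n →ₗ[ℝ] E n) := by
    refine AddMonoidHomClass.isometry_of_norm _ fun y => ?_
    simp
  rw [surfaceMass, surfaceMass, supportFn_neg, neg_eq_map, P.face_map, adjoint_neg_id, norm_neg,
    hiso.euclideanHausdorffMeasure_image]

/-- The support function and face of a union and an intersection of polytopes in a direction where
one of them reaches farther. -/
theorem face_of_supportFn_lt {P Q U I : PolytopeO n} (hU : U.carrier = P.carrier ∪ Q.carrier)
    (hI : I.carrier = P.carrier ∩ Q.carrier) {x : E n}
    (hlt : supportFn Q.carrier x < supportFn P.carrier x) :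
    supportFn U.carrier x = supportFn P.carrier x ∧ face U.carrier x = face P.carrier x ∧
    supportFn I.carrier x = supportFn Q.carrier x ∧ face I.carrier x = face Q.carrier x := by
  obtain ⟨z, hz, hzh⟩ := P.face_nonempty x
  obtain ⟨y, hy, hyh⟩ := Q.face_nonempty x
  -- Moving from y towards a point z of P beyond Q's supporting hyperplane leaves Q at once but
  -- stays in the convex union, hence in P; P is closed.
  have hsub : ∀ y ∈ face Q.carrier x, y ∈ P.carrier := by
    rintro y ⟨hy, hyh⟩
    have hlim : Filter.Tendsto (fun t : ℝ => (1 - t) • y + t • z) (nhdsWithin 0 (Set.Ioi 0))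
        (nhds ((1 - 0 : ℝ) • y + (0 : ℝ) • z)) := by
      apply Filter.Tendsto.mono_left _ nhdsWithin_le_nhds
      apply Continuous.tendsto
      fun_prop
    rw [sub_zero, one_smul, zero_smul, add_zero] at hlim
    refine P.isCompact.isClosed.mem_of_tendsto hlim ?_
    filter_upwards [Ioo_mem_nhdsGT (zero_lt_one (α := ℝ))] with t ht
    have hmem : (1 - t) • y + t • z ∈ U.carrier :=
      U.convex (hU ▸ Or.inr hy) (hU ▸ Or.inl hz) (by linarith [ht.2]) ht.1.le (by ring)
    rw [hU] at hmem
    refine hmem.resolve_right fun hmQ => ?_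
    have h1 := Q.inner_le_supportFn (x := x) hmQ
    rw [inner_add_right, inner_smul_right, inner_smul_right, hyh, hzh] at h1
    have := mul_pos ht.1 (sub_pos.2 hlt)
    linarith
  have h1 : supportFn U.carrier x = supportFn P.carrier x := by
    refine U.supportFn_eq (fun a ha => ?_) (hU ▸ Or.inl hz) hzh
    rw [hU] at ha
    rcases ha with ha | ha
    · exact P.inner_le_supportFn ha
    · exact (Q.inner_le_supportFn ha).trans hlt.le
  have h2 : supportFn I.carrier x = supportFn Q.carrier x := by
    refine I.supportFn_eq (fun a ha => ?_) (y := y) (hI ▸ ⟨hsub y ⟨hy, hyh⟩, hy⟩) hyh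
    rw [hI] at ha
    exact Q.inner_le_supportFn ha.2
  refine ⟨h1, ?_, h2, ?_⟩
  · ext a
    simp only [face, Set.mem_ofPred_eq, h1]
    rw [hU, Set.mem_union]
    constructor
    · rintro ⟨ha | ha, h⟩
      · exact ⟨ha, h⟩
      · have := Q.inner_le_supportFn (x := x) ha
        linarith
    · rintro ⟨ha, h⟩
      exact ⟨Or.inl ha, h⟩
  · ext a
    constructor
    · rintro ⟨ha, h⟩
      rw [hI] at ha
      exact ⟨ha.2, h.trans h2⟩
    · intro ha
      refine ⟨hI ▸ ⟨hsub a ha, ha.1⟩, ha.2.trans h2.symm⟩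

theorem face_of_supportFn_eq {P Q U I : PolytopeO n} (hU : U.carrier = P.carrier ∪ Q.carrier)
    (hI : I.carrier = P.carrier ∩ Q.carrier) {x : E n}
    (heq : supportFn P.carrier x = supportFn Q.carrier x) :
    supportFn U.carrier x = supportFn Q.carrier x ∧
    face U.carrier x = face P.carrier x ∪ face Q.carrier x ∧
    supportFn I.carrier x = supportFn Q.carrier x ∧
    face I.carrier x = face P.carrier x ∩ face Q.carrier x := by
  obtain ⟨z, hz, hzh⟩ := P.face_nonempty x
  have h1 : supportFn U.carrier x = supportFn Q.carrier x := by
    refine U.supportFn_eq (fun a ha => ?_) (hU ▸ Or.inl hz) (hzh.trans heq)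
    rw [hU] at ha
    rcases ha with ha | ha
    · exact heq ▸ P.inner_le_supportFn ha
    · exact Q.inner_le_supportFn ha
  have h2 : face U.carrier x = face P.carrier x ∪ face Q.carrier x := by
    ext a
    simp only [face, Set.mem_ofPred_eq, Set.mem_union, h1, heq]
    rw [hU, Set.mem_union]
    tauto
  -- The face of U is convex, hence connected, so the two nonempty closed faces covering it must
  -- meet.
  obtain ⟨y, hyU, hyP, hyQ⟩ := isPreconnected_closed_iff.1 (U.convex_face x).isPreconnected _ _
    (P.isCompact_face x).isClosed (Q.isCompact_face x).isClosed h2.subset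
    (by rw [h2, Set.inter_eq_right.2 Set.subset_union_left]; exact P.face_nonempty x)
    (by rw [h2, Set.inter_eq_right.2 Set.subset_union_right]; exact Q.face_nonempty x)
  have h3 : supportFn I.carrier x = supportFn Q.carrier x := by
    refine I.supportFn_eq (fun a ha => ?_) (y := y) (hI ▸ ⟨hyP.1, hyQ.1⟩) hyQ.2
    rw [hI] at ha
    exact Q.inner_le_supportFn ha.2
  refine ⟨h1, h2, h3, ?_⟩
  ext a
  simp only [face, Set.mem_ofPred_eq, Set.mem_inter_iff, h3, heq]
  rw [hI, Set.mem_inter_iff]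
  tauto

/-- If the support functions differ at x, then U and I have the faces of P and Q in some order. If
they agree, the faces of U and I are the union and the intersection, and the measure of faces is
additive. -/
theorem surfaceMass_valuation {P Q U I : PolytopeO n} (hU : U.carrier = P.carrier ∪ Q.carrier)
    (hI : I.carrier = P.carrier ∩ Q.carrier) {x : E n} (hx : x ≠ 0) :
    surfaceMass p U x + surfaceMass p I x = surfaceMass p P x + surfaceMass p Q x := by
  rcases lt_trichotomy (supportFn P.carrier x) (supportFn Q.carrier x) with h | h | h
  · obtain ⟨h1, h2, h3, h4⟩ := face_of_supportFn_lt (hU.trans (Set.union_comm _ _))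
      (hI.trans (Set.inter_comm _ _)) h
    simp only [surfaceMass, h1, h2, h3, h4]
    ring
  · obtain ⟨h1, h2, h3, h4⟩ := face_of_supportFn_eq hU hI h
    have hP := (P.face_lt_top hx).ne
    have hQ := (Q.face_lt_top hx).ne
    have hadd := measureReal_union_add_inter (μ := μHE[n - 1]) (s := face P.carrier x)
      (Q.isCompact_face x).measurableSet hP hQ
    simp only [measureReal_def] at hadd
    simp only [surfaceMass, h1, h2, h3, h4, h]
    split_ifs
    · rw [← mul_add, ← mul_add, hadd]
      ring
    · rfl
  · obtain ⟨h1, h2, h3, h4⟩ := face_of_supportFn_lt hU hI h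
    simp only [surfaceMass, h1, h2, h3, h4]

/-! ### Finiteness of the set of facet normals -/

theorem vectorSpan_face_le (P : PolytopeO n) (x : E n) :
    vectorSpan ℝ (face P.carrier x) ≤ (ℝ ∙ x)ᗮ := by
  rw [vectorSpan_def, Submodule.span_le]
  rintro _ ⟨y, hy, z, hz, rfl⟩
  rw [SetLike.mem_coe, Submodule.mem_orthogonal_singleton_iff_inner_right]
  simp only [vsub_eq_sub, inner_sub_right, hy.2, hz.2, sub_self]

theorem finrank_orthogonal_singleton {x : E n} (hx : x ≠ 0) :
    Module.finrank ℝ (ℝ ∙ x)ᗮ + 1 = n := by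
  have := (ℝ ∙ x).finrank_add_finrank_orthogonal
  rw [finrank_span_singleton hx, finrank_euclideanSpace_fin] at this
  omega

theorem zero_notMem_face_iff (P : PolytopeO n) (x : E n) :
    (0 : E n) ∉ face P.carrier x ↔ 0 < supportFn P.carrier x := by
  have : (0 : E n) ∈ face P.carrier x ↔ supportFn P.carrier x = 0 := by
    simp only [face, Set.mem_ofPred_eq, P.zero_mem, true_and, inner_zero_right, eq_comm]
  rw [this, (P.supportFn_nonneg x).lt_iff_ne, ne_comm]

/-- A convex combination attains the maximum only if every point of positive weight does. -/
theorem face_subset_convexHull {P : PolytopeO n} {V : Finset (E n)}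
    (hV : P.carrier = convexHull ℝ (V : Set (E n))) (x : E n) :
    face P.carrier x = convexHull ℝ ((V : Set (E n)) ∩ face P.carrier x) := by
  classical
  refine Set.Subset.antisymm ?_ (convexHull_min Set.inter_subset_right (P.convex_face x))
  rintro y ⟨hy, hyh⟩
  rw [hV] at hy
  obtain ⟨w, hw0, hw1, hw⟩ := Finset.mem_convexHull'.1 hy
  have hVP : ∀ v ∈ V, v ∈ P.carrier := fun v hv => hV ▸ subset_convexHull ℝ _ hv
  have hsum : ∑ v ∈ V, w v * (supportFn P.carrier x - inner ℝ x v) = 0 := by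
    simp only [mul_sub, Finset.sum_sub_distrib, ← Finset.sum_mul, hw1, one_mul]
    rw [← hyh, ← hw, inner_sum]
    simp only [inner_smul_right, sub_self]
  have hz := (Finset.sum_eq_zero_iff_of_nonneg fun v hv =>
    mul_nonneg (hw0 v hv) (sub_nonneg.2 (P.inner_le_supportFn (hVP v hv)))).1 hsum
  have hsupp : ∀ v ∈ V, v ∉ V.filter (· ∈ face P.carrier x) → w v = 0 := by
    intro v hv hv'
    refine (mul_eq_zero.1 (hz v hv)).resolve_right fun h => hv' ?_
    exact Finset.mem_filter.2 ⟨hv, hVP v hv, (sub_eq_zero.1 h).symm⟩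
  rw [← hw, ← Finset.sum_subset (Finset.filter_subset (· ∈ face P.carrier x) V)
    fun v hv hv' => by rw [hsupp v hv hv', zero_smul]]
  refine (convex_convexHull ℝ _).sum_mem (fun v hv => hw0 v (Finset.mem_filter.1 hv).1) ?_
    fun v hv => subset_convexHull ℝ _ (by simpa using hv)
  rw [← hw1]
  exact Finset.sum_subset (Finset.filter_subset _ _) hsupp

/-- A facet spans the orthogonal complement of its normal, which fixes the normal up to sign;
positivity of the support function fixes the sign. -/
theorem eq_of_face_eq (P : PolytopeO n) {u u' : Sph n} (hu : u ∈ facetNormalsStar P)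
    (hu' : u' ∈ facetNormalsStar P)
    (h : face P.carrier (u : E n) = face P.carrier (u' : E n)) : u = u' := by
  have hspan : ∀ v ∈ facetNormalsStar P,
      vectorSpan ℝ (face P.carrier (v : E n)) = (ℝ ∙ (v : E n))ᗮ := by
    intro v hv
    refine Submodule.eq_of_le_of_finrank_eq (vectorSpan_face_le P v) ?_
    have h1 := finrank_orthogonal_singleton (Sph.ne_zero v)
    have h2 := hv.1
    omega
  have h1 : (ℝ ∙ (u : E n)) = (ℝ ∙ (u' : E n)) := by
    rw [← Submodule.orthogonal_orthogonal (ℝ ∙ (u : E n)), ← hspan u hu, h, hspan u' hu',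
      Submodule.orthogonal_orthogonal]
  have h2 : (u : E n) ∈ (ℝ ∙ (u' : E n)) := h1 ▸ Submodule.mem_span_singleton_self _
  obtain ⟨c, hc⟩ := Submodule.mem_span_singleton.1 h2
  have hpos := (zero_notMem_face_iff P u).1 hu.2
  have hpos' := (zero_notMem_face_iff P u').1 hu'.2
  obtain ⟨y, hy⟩ := P.face_nonempty (u : E n)
  have hy' : y ∈ face P.carrier (u' : E n) := h ▸ hy
  have hcy : c * supportFn P.carrier (u' : E n) = supportFn P.carrier (u : E n) := by
    rw [← hy.2, ← hy'.2, ← hc, inner_smul_left, conj_trivial]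
  have hc0 : 0 < c := pos_of_mul_pos_left (hcy ▸ hpos) hpos'.le
  have hn := congrArg norm hc
  rw [norm_smul, mem_sphere_zero_iff_norm.1 u.2, mem_sphere_zero_iff_norm.1 u'.2, mul_one,
    Real.norm_of_nonneg hc0.le] at hn
  rw [hn, one_smul] at hc
  exact Subtype.ext hc.symm

theorem finite_facetNormalsStar (P : PolytopeO n) : (facetNormalsStar P).Finite := by
  obtain ⟨V, hV⟩ := P.isPolytope
  refine Set.Finite.of_finite_image (f := fun u : Sph n => (V : Set (E n)) ∩ face P.carrier u)
    (V.finite_toSet.finite_subsets.subset ?_) fun u hu u' hu' h => ?_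
  · rintro _ ⟨u, -, rfl⟩
    exact Set.inter_subset_left
  · refine eq_of_face_eq P hu hu' ?_
    rw [face_subset_convexHull hV, face_subset_convexHull hV (u' : E n)]
    exact congrArg _ h

theorem lpSurfaceArea_compl (P : PolytopeO n) : lpSurfaceArea p P (facetNormalsStar P)ᶜ = 0 := by
  rw [lpSurfaceArea, Measure.sum_apply _ (finite_facetNormalsStar P).measurableSet.compl,
    ENNReal.tsum_eq_zero]
  intro u
  rw [Measure.smul_apply, Measure.dirac_apply' _ (finite_facetNormalsStar P).measurableSet.compl,
    Set.indicator_of_notMem (Set.notMem_compl_iff.2 u.2), smul_zero]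

/-- `surfaceMass` imposes no dimension condition on the face; faces that are not facets have
(n-1)-dimensional measure zero. -/
theorem lpSurfaceArea_singleton (P : PolytopeO n) (u : Sph n) :
    lpSurfaceArea p P {u} = ENNReal.ofReal (surfaceMass p P u) := by
  rw [lpSurfaceArea, Measure.sum_apply _ (measurableSet_singleton u)]
  have hval : ∀ v : facetNormalsStar P, (v : Sph n) ≠ u →
      ((ENNReal.ofReal (supportFn P.carrier (v : Sph n) ^ (1 - p)) *
      μHE[n - 1] (face P.carrier (v : Sph n))) • Measure.dirac (v : Sph n)) {u} = 0 := by
    intro v hv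
    rw [Measure.smul_apply, Measure.dirac_apply' _ (measurableSet_singleton u),
      Set.indicator_of_notMem (by simpa using hv), smul_zero]
  have hu1 : ‖(u : E n)‖ = 1 := mem_sphere_zero_iff_norm.1 u.2
  by_cases hu : u ∈ facetNormalsStar P
  · rw [tsum_eq_single ⟨u, hu⟩ fun v hv => hval v fun h => hv (Subtype.ext h), Measure.smul_apply,
      Measure.dirac_apply' _ (measurableSet_singleton u), Set.indicator_of_mem (by simp),
      Pi.one_apply, smul_eq_mul, mul_one]
    have hpos := (zero_notMem_face_iff P u).1 hu.2
    rw [surfaceMass, if_pos hpos, hu1, inv_one, one_mul,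
      ENNReal.ofReal_mul (Real.rpow_nonneg hpos.le _),
      ENNReal.ofReal_toReal (P.face_lt_top (Sph.ne_zero u)).ne]
  · rw [ENNReal.tsum_eq_zero.2 fun v => hval v fun h => hu (h ▸ v.2), surfaceMass]
    split_ifs with hpos
    · have hne : Module.finrank ℝ (vectorSpan ℝ (face P.carrier (u : E n))) + 1 ≠ n := fun h =>
        hu ⟨h, (zero_notMem_face_iff P u).2 hpos⟩
      have h1 := Submodule.finrank_mono (vectorSpan_face_le P (u : E n))
      have h2 := finrank_orthogonal_singleton (Sph.ne_zero u)
      rw [euclideanHausdorffMeasure_eq_zero_of_finrank_lt (d := n - 1) (by omega)]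
      simp
    · simp

theorem isMassFunction_surfaceMass : IsMassFunction (n := n) p (surfaceMass p) where
  nonneg := surfaceMass_nonneg
  valuation P Q U I hU hI x hx := surfaceMass_valuation hU hI hx
  smul P x t ht _ := surfaceMass_smul P x t ht
  map L hL P x hx := surfaceMass_map hL P hx
  countable P := by
    refine (finite_facetNormalsStar P).countable.mono fun u hu => ?_
    by_contra h
    have h1 : lpSurfaceArea p P {u} = 0 :=
      measure_mono_null (Set.singleton_subset_iff.2 h) (lpSurfaceArea_compl P)
    rw [lpSurfaceArea_singleton, ENNReal.ofReal_eq_zero] at h1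
    exact hu (le_antisymm h1 (surfaceMass_nonneg P u))

/-- The unit cylinder over the facet in {y₀ = 1} contains the ball of radius 1/2 about (3/2, 1/2, …,
1/2), so the facet has positive measure. -/
theorem surfaceMass_box_pos {d : ℕ} :
    0 < surfaceMass p (box (0 : Fin d → ℝ) (fun _ => 1)) (unitVec 0) := by
  set B := box (0 : Fin d → ℝ) (fun _ => 1) with hB
  have h1mem : lift (fun _ : Fin d => (1 : ℝ)) ∈ B.carrier := by
    rw [hB, mem_box]
    simp
  have hsupp : supportFn B.carrier (unitVec 0) = 1 := by
    refine B.supportFn_eq (fun y hy => ?_) h1mem (by rw [inner_unitVec, lift_zero])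
    rw [inner_unitVec]
    exact (mem_box.1 hy).1.2
  have hn : ‖(unitVec 0 : E (d + 1))‖ = 1 := by simp
  rw [surfaceMass, if_pos (by rw [hsupp]; exact one_pos), hsupp, Real.one_rpow, one_mul, hn, inv_one,
    one_mul, ENNReal.toReal_pos_iff]
  refine ⟨?_, B.face_lt_top (unitVec_ne_zero 0)⟩
  have hcyl := volume_cylinder (B.isCompact_face (unitVec 0)) (unitVec_ne_zero 0)
    (fun y hy => hy.2) (v := unitVec 0) (c := 1) (by rw [inner_unitVec]; simp) one_pos
  rw [hn, div_one, ENNReal.ofReal_one, one_mul] at hcyl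
  rw [← hcyl]
  let c : E (d + 1) := WithLp.toLp 2 (Fin.cons (3 / 2) fun _ => 1 / 2)
  refine (Metric.measure_ball_pos volume c (by norm_num : (0 : ℝ) < 1 / 2)).trans_le
    (measure_mono fun y hy => ?_)
  have hyc : ∀ i, |y i - c i| ≤ 1 / 2 := by
    intro i
    rw [mem_ball_iff_norm] at hy
    have := PiLp.norm_apply_le (y - c) i
    rw [PiLp.sub_apply, Real.norm_eq_abs] at this
    linarith
  have h0 := abs_le.1 (hyc 0)
  have hc0 : c 0 = 3 / 2 := rfl
  have hcs : ∀ i : Fin d, c i.succ = 1 / 2 := fun i => rfl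
  rw [hc0] at h0
  refine ⟨(lift fun i => y i.succ, y 0 - 1), ⟨⟨?_, ?_⟩, ?_, ?_⟩, ?_⟩
  · rw [hB, mem_box]
    simp only [lift_zero, lift_succ, Pi.zero_apply]
    refine ⟨by norm_num, fun i => ?_⟩
    have := abs_le.1 (hyc i.succ)
    rw [hcs] at this
    constructor <;> linarith
  · rw [inner_unitVec, lift_zero, hsupp]
  · show 0 ≤ y 0 - 1
    linarith
  · show y 0 - 1 ≤ 1
    linarith
  · ext i
    refine Fin.cases ?_ (fun j => ?_) i <;> simp

theorem surfaceMass_box_neg {d : ℕ} :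
    surfaceMass p (box (0 : Fin d → ℝ) (fun _ => 1)) (-unitVec 0) = 0 := by
  rw [surfaceMass, if_neg]
  rw [not_lt]
  refine (PolytopeO.supportFn_eq _ (fun y hy => ?_) (PolytopeO.zero_mem _) (inner_zero_right _)).le
  rw [inner_neg_left, inner_unitVec, neg_nonpos]
  exact (mem_box.1 hy).1.1

end

section

/-! ### Discrete measures on the sphere and their atoms -/

variable {n : ℕ} {p : ℝ}

theorem measure_ext_of_singleton {α : Type*} [MeasurableSpace α] [MeasurableSingletonClass α]
    {ν ν' : Measure α} {N N' : Set α} (hN : N.Countable) (hN' : N'.Countable) (hν : ν Nᶜ = 0)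
    (hν' : ν' N'ᶜ = 0) (h : ∀ u, ν {u} = ν' {u}) : ν = ν' := by
  have key : ∀ ρ : Measure α, ρ (N ∪ N')ᶜ = 0 → ∀ A : Set α,
      ρ A = ∑' u : (A ∩ (N ∪ N') : Set α), ρ {(u : α)} := by
    intro ρ hρ A
    have hc : (A ∩ (N ∪ N')).Countable := (hN.union hN').mono Set.inter_subset_right
    have h1 : ρ A = ρ (A ∩ (N ∪ N')) := by
      refine le_antisymm ?_ (measure_mono Set.inter_subset_left)
      calc ρ A ≤ ρ (A ∩ (N ∪ N') ∪ (N ∪ N')ᶜ) := measure_mono fun a ha => by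
            by_cases h : a ∈ N ∪ N'
            · exact Or.inl ⟨ha, h⟩
            · exact Or.inr h
        _ ≤ ρ (A ∩ (N ∪ N')) + ρ (N ∪ N')ᶜ := measure_union_le _ _
        _ = _ := by rw [hρ, add_zero]
    rw [h1]
    conv_lhs => rw [← Set.biUnion_of_singleton (A ∩ (N ∪ N'))]
    exact measure_biUnion hc (fun a _ b _ hab => Set.disjoint_singleton.2 hab)
      fun a _ => measurableSet_singleton a
  ext A _
  rw [key ν (measure_mono_null (Set.compl_subset_compl.2 Set.subset_union_left) hν),
    key ν' (measure_mono_null (Set.compl_subset_compl.2 Set.subset_union_right) hν')]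
  simp_rw [h]

theorem IsDiscrete.ext {ν ν' : FiniteMeasure (Sph n)} (hν : IsDiscrete ν) (hν' : IsDiscrete ν')
    (h : ∀ u, (ν : Measure (Sph n)).real {u} = (ν' : Measure (Sph n)).real {u}) : ν = ν' := by
  obtain ⟨N, hN, hN0⟩ := hν
  obtain ⟨N', hN', hN0'⟩ := hν'
  refine FiniteMeasure.toMeasure_injective (measure_ext_of_singleton hN hN' hN0 hN0' fun u => ?_)
  exact (measureReal_eq_measureReal_iff (measure_ne_top _ _) (measure_ne_top _ _)).1 (h u)

theorem IsDiscrete.add {ν ν' : FiniteMeasure (Sph n)} (hν : IsDiscrete ν) (hν' : IsDiscrete ν') :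
    IsDiscrete (ν + ν') := by
  obtain ⟨N, hN, hN0⟩ := hν
  obtain ⟨N', hN', hN0'⟩ := hν'
  refine ⟨N ∪ N', hN.union hN', ?_⟩
  rw [FiniteMeasure.toMeasure_add, Measure.add_apply,
    measure_mono_null (Set.compl_subset_compl.2 Set.subset_union_left) hN0,
    measure_mono_null (Set.compl_subset_compl.2 Set.subset_union_right) hN0', add_zero]

theorem norm_sph (u : Sph n) : ‖(u : E n)‖ = 1 := mem_sphere_zero_iff_norm.1 u.2

theorem dir_sph (u : Sph n) : dir (u : E n) (Sph.ne_zero u) = u := by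
  apply Subtype.ext
  simp [dir]

theorem dir_smul {x : E n} (hx : x ≠ 0) {t : ℝ} (ht : 0 < t) (h : t • x ≠ 0) :
    dir (t • x) h = dir x hx := by
  apply Subtype.ext
  simp only [dir, norm_smul, Real.norm_of_nonneg ht.le, mul_inv, smul_smul]
  congr 1
  field_simp

theorem continuous_dir {X : Type*} [TopologicalSpace X] {g : X → E n} (hg : Continuous g)
    (h : ∀ x, g x ≠ 0) : Continuous fun x => dir (g x) (h x) :=
  Continuous.subtype_mk ((hg.norm.inv₀ fun x => norm_ne_zero_iff.2 (h x)).smul hg) _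

open Classical in
/-- The homogeneous function of degree `-p` describing the atoms of a measure. -/
def atomMass (p : ℝ) (ν : FiniteMeasure (Sph n)) (x : E n) : ℝ :=
  if hx : x ≠ 0 then ‖x‖ ^ (-p) * (ν : Measure (Sph n)).real {dir x hx} else 0

theorem atomMass_nonneg (ν : FiniteMeasure (Sph n)) (x : E n) : 0 ≤ atomMass p ν x := by
  rw [atomMass]
  split_ifs
  · have := Real.rpow_nonneg (norm_nonneg x) (-p)
    positivity
  · exact le_rfl

theorem atomMass_sph (ν : FiniteMeasure (Sph n)) (u : Sph n) :
    atomMass p ν u = (ν : Measure (Sph n)).real {u} := by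
  rw [atomMass, dif_pos (Sph.ne_zero u), norm_sph, Real.one_rpow, one_mul, dir_sph]

theorem atomMass_smul (ν : FiniteMeasure (Sph n)) {x : E n} (hx : x ≠ 0) {t : ℝ} (ht : 0 < t) :
    atomMass p ν (t • x) = t ^ (-p) * atomMass p ν x := by
  have h : t • x ≠ 0 := smul_ne_zero ht.ne' hx
  rw [atomMass, atomMass, dif_pos h, dif_pos hx, dir_smul hx ht, norm_smul,
    Real.norm_of_nonneg ht.le, Real.mul_rpow ht.le (norm_nonneg _), mul_assoc]

/-! ### Linear automorphisms acting on measures on the sphere -/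

section Push

variable (K : E n ≃ₗ[ℝ] E n)

theorem map_sph_ne_zero (u : Sph n) : K u ≠ 0 := fun h =>
  Sph.ne_zero u (K.map_eq_zero_iff.1 h)

/-- The map induced by a linear automorphism on the sphere of directions. -/
def sphMap (u : Sph n) : Sph n := dir (K u) (map_sph_ne_zero K u)

theorem continuous_map_sph : Continuous fun u : Sph n => K u :=
  (K : E n →ₗ[ℝ] E n).continuous_of_finiteDimensional.comp continuous_subtype_val

theorem continuous_sphMap : Continuous (sphMap K) := continuous_dir (continuous_map_sph K) _

theorem sphMap_symm_apply (u : Sph n) : sphMap K.symm (sphMap K u) = u := by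
  have h : (sphMap K u : E n) = ‖K u‖⁻¹ • K u := rfl
  have hpos : 0 < ‖K u‖⁻¹ := inv_pos.2 (norm_pos_iff.2 (map_sph_ne_zero K u))
  have h2 : K.symm (sphMap K u) = ‖K u‖⁻¹ • (u : E n) := by rw [h, map_smul, K.symm_apply_apply]
  have h3 : ‖K u‖⁻¹ • (u : E n) ≠ 0 := smul_ne_zero hpos.ne' (Sph.ne_zero u)
  calc sphMap K.symm (sphMap K u) = dir (‖K u‖⁻¹ • (u : E n)) h3 := by
        simp only [sphMap] at h2 ⊢
        simp only [h2]
    _ = u := by rw [dir_smul (Sph.ne_zero u) hpos, dir_sph]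

theorem sphMap_apply_symm (u : Sph n) : sphMap K (sphMap K.symm u) = u :=
  sphMap_symm_apply K.symm u

theorem continuous_norm_map_rpow (p : ℝ) : Continuous fun u : Sph n => ‖K u‖ ^ p :=
  (continuous_map_sph K).norm.rpow_const fun u => Or.inl (norm_ne_zero_iff.2 (map_sph_ne_zero K u))

/-- The image of a measure on the sphere under a linear automorphism, with the density that turns
it into the dual of the action on homogeneous functions of degree `p`. -/
def pushMeasure (p : ℝ) (ν : Measure (Sph n)) : Measure (Sph n) :=
  (ν.withDensity fun u => ENNReal.ofReal (‖K u‖ ^ p)).map (sphMap K)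

theorem isFiniteMeasure_pushMeasure (ν : Measure (Sph n)) [IsFiniteMeasure ν] :
    IsFiniteMeasure (pushMeasure K p ν) := by
  have hint : Integrable (fun u : Sph n => ‖K u‖ ^ p) ν :=
    (continuous_norm_map_rpow K p).integrable_of_hasCompactSupport
      (HasCompactSupport.of_compactSpace _)
  have := isFiniteMeasure_withDensity_ofReal hint.2
  rw [pushMeasure]
  infer_instance

theorem integral_pushMeasure (ν : Measure (Sph n)) {g : Sph n → ℝ} (hg : Continuous g) :
    ∫ v, g v ∂(pushMeasure K p ν) = ∫ u, ‖K u‖ ^ p * g (sphMap K u) ∂ν := by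
  rw [pushMeasure, integral_map (continuous_sphMap K).measurable.aemeasurable
      hg.aestronglyMeasurable, integral_withDensity_eq_integral_toReal_smul
      (continuous_norm_map_rpow K p).measurable.ennreal_ofReal
      (Filter.Eventually.of_forall fun _ => ENNReal.ofReal_lt_top)]
  refine integral_congr_ae (Filter.Eventually.of_forall fun u => ?_)
  simp only [smul_eq_mul]
  rw [ENNReal.toReal_ofReal (Real.rpow_nonneg (norm_nonneg _) _)]

theorem pushMeasure_singleton (ν : Measure (Sph n)) (u : Sph n) :
    pushMeasure K p ν {sphMap K u} = ENNReal.ofReal (‖K u‖ ^ p) * ν {u} := by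
  have hpre : sphMap K ⁻¹' {sphMap K u} = {u} := by
    ext v
    simp only [Set.mem_preimage, Set.mem_singleton_iff]
    refine ⟨fun h => ?_, fun h => by rw [h]⟩
    rw [← sphMap_symm_apply K v, h, sphMap_symm_apply]
  rw [pushMeasure, Measure.map_apply (continuous_sphMap K).measurable (measurableSet_singleton _),
    hpre, withDensity_apply _ (measurableSet_singleton _), lintegral_singleton]

theorem pushMeasure_compl (ν : Measure (Sph n)) {N : Set (Sph n)} (hN : N.Countable)
    (h : ν Nᶜ = 0) : pushMeasure K p ν (sphMap K '' N)ᶜ = 0 := by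
  rw [pushMeasure, Measure.map_apply (continuous_sphMap K).measurable
    (hN.image _).measurableSet.compl]
  refine withDensity_absolutelyContinuous _ _ (measure_mono_null ?_ h)
  intro u hu huN
  exact hu ⟨u, huN, rfl⟩

/-- Every continuous function on the sphere extends homogeneously of degree p, and finite measures
are determined by integrals of continuous functions. Homogeneity, f(Ku) = ‖Ku‖^p f(Ku/‖Ku‖),
produces the density. -/
theorem eq_pushMeasure_iff_integral (ν ν' : FiniteMeasure (Sph n)) :
    (ν' : Measure (Sph n)) = pushMeasure K p ν ↔ ∀ f : E n → ℝ, IsContHomogeneous p f →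
      ∫ u : Sph n, f u ∂(ν' : Measure (Sph n)) = ∫ u : Sph n, f (K u) ∂(ν : Measure (Sph n)) := by
  constructor
  · intro h f hf
    have hfc : Continuous fun u : Sph n => f u :=
      hf.continuousOn.comp_continuous continuous_subtype_val fun u => Sph.ne_zero u
    rw [h, integral_pushMeasure K _ hfc]
    refine integral_congr_ae (Filter.Eventually.of_forall fun u => ?_)
    have hne := map_sph_ne_zero K u
    have h1 := hf.homogeneous ‖K u‖ (norm_pos_iff.2 hne) (sphMap K u) (Sph.ne_zero _)
    have h2 : ‖K u‖ • (sphMap K u : E n) = K u := norm_smul_dir _ _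
    rw [h2] at h1
    exact h1.symm
  · intro h
    have := isFiniteMeasure_pushMeasure (p := p) K (ν : Measure (Sph n))
    refine ext_of_forall_integral_eq_of_IsFiniteMeasure fun g => ?_
    classical
    let f : E n → ℝ := fun x => if hx : x ≠ 0 then ‖x‖ ^ p * g (dir x hx) else 0
    have hf : IsContHomogeneous p f := by
      constructor
      · rw [continuousOn_iff_continuous_domRestrict]
        have : Set.domRestrict {0}ᶜ f =
            fun x : ({0}ᶜ : Set (E n)) => ‖(x : E n)‖ ^ p * g (dir (x : E n) x.2) := by
          funext x
          have hx : (x : E n) ≠ 0 := x.2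
          simp only [Set.domRestrict_apply, f, dif_pos hx]
        rw [this]
        refine Continuous.mul ?_ (g.continuous.comp (continuous_dir continuous_subtype_val _))
        exact continuous_subtype_val.norm.rpow_const fun x => Or.inl (norm_ne_zero_iff.2 x.2)
      · intro t ht x hx
        have h : t • x ≠ 0 := smul_ne_zero ht.ne' hx
        simp only [f, dif_pos hx, dif_pos h]
        rw [dir_smul hx ht, norm_smul, Real.norm_of_nonneg ht.le,
          Real.mul_rpow ht.le (norm_nonneg _), mul_assoc]
    rw [integral_pushMeasure K _ g.continuous]
    refine Eq.trans ?_ ((h f hf).trans ?_)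
    · refine integral_congr_ae (Filter.Eventually.of_forall fun u => ?_)
      simp only [f, dif_pos (Sph.ne_zero u), norm_sph, Real.one_rpow, one_mul, dir_sph]
    · refine integral_congr_ae (Filter.Eventually.of_forall fun u => ?_)
      simp only [f, dif_pos (map_sph_ne_zero K u)]
      rfl

/-- Discrete measures are determined by their atoms, and the weight ‖Ku‖^p of the pushed atom
cancels the factor ‖Ku‖^(-p) in `atomMass`. -/
theorem eq_pushMeasure_iff_atomMass {ν ν' : FiniteMeasure (Sph n)} (hν : IsDiscrete ν)
    (hν' : IsDiscrete ν') : (ν' : Measure (Sph n)) = pushMeasure K p ν ↔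
      ∀ x, x ≠ 0 → atomMass p ν' (K x) = atomMass p ν x := by
  have hfin := isFiniteMeasure_pushMeasure (p := p) K (ν : Measure (Sph n))
  have hsph : ∀ u : Sph n, atomMass p ν' (K u) =
      ‖K u‖ ^ (-p) * (ν' : Measure (Sph n)).real {sphMap K u} := fun u => by
    rw [atomMass, dif_pos (map_sph_ne_zero K u)]
    rfl
  have hpos : ∀ u : Sph n, 0 < ‖K u‖ := fun u => norm_pos_iff.2 (map_sph_ne_zero K u)
  have hreal : ∀ u : Sph n, (pushMeasure K p (ν : Measure (Sph n))).real {sphMap K u} =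
      ‖K u‖ ^ p * (ν : Measure (Sph n)).real {u} := fun u => by
    rw [measureReal_def, pushMeasure_singleton, ENNReal.toReal_mul,
      ENNReal.toReal_ofReal (Real.rpow_nonneg (norm_nonneg _) _)]
    rfl
  constructor
  · intro h
    have key : ∀ u : Sph n, atomMass p ν' (K u) = atomMass p ν u := by
      intro u
      rw [hsph, h, hreal, ← mul_assoc, ← Real.rpow_add (hpos u), neg_add_cancel, Real.rpow_zero,
        one_mul, atomMass_sph]
    intro x hx
    have hx0 := norm_pos_iff.2 hx
    rw [← norm_smul_dir x hx, map_smul, atomMass_smul _ (map_sph_ne_zero K _) hx0,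
      atomMass_smul _ (Sph.ne_zero _) hx0, key]
  · intro h
    obtain ⟨N, hN, hN0⟩ := hν
    obtain ⟨N', hN', hN0'⟩ := hν'
    refine measure_ext_of_singleton hN' (hN.image (sphMap K)) hN0' (pushMeasure_compl K _ hN hN0)
      fun v => ?_
    rw [← sphMap_apply_symm K v]
    refine (measureReal_eq_measureReal_iff (measure_ne_top _ _) (measure_ne_top _ _)).1 ?_
    rw [hreal, ← atomMass_sph (p := p) ν, ← h _ (Sph.ne_zero _), hsph, ← mul_assoc,
      ← Real.rpow_add (hpos _), add_neg_cancel, Real.rpow_zero, one_mul]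

end Push

/-! ### Contravariance in terms of atoms -/

/-- The adjoint of the inverse of a linear automorphism. -/
def contragredient (A : E n ≃ₗ[ℝ] E n) : E n ≃ₗ[ℝ] E n :=
  LinearEquiv.ofLinearMap (LinearMap.adjoint (A.symm : E n →ₗ[ℝ] E n))
    (LinearMap.adjoint (A : E n →ₗ[ℝ] E n))
    (by rw [← LinearMap.adjoint_comp]; simp) (by rw [← LinearMap.adjoint_comp]; simp)

theorem contragredient_apply (A : E n ≃ₗ[ℝ] E n) (x : E n) :
    contragredient A x = LinearMap.adjoint (A.symm : E n →ₗ[ℝ] E n) x := rfl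

theorem contragredient_symm_apply (A : E n ≃ₗ[ℝ] E n) (x : E n) :
    (contragredient A).symm x = LinearMap.adjoint (A : E n →ₗ[ℝ] E n) x := rfl

/-- The linear automorphism given by an invertible matrix. -/
def glEquiv (φ : GL (Fin n) ℝ) : E n ≃ₗ[ℝ] E n :=
  LinearEquiv.ofLinearMap (Matrix.toEuclideanLin (φ : Matrix (Fin n) (Fin n) ℝ))
    (Matrix.toEuclideanLin ((φ⁻¹ : GL (Fin n) ℝ) : Matrix (Fin n) (Fin n) ℝ))
    (by ext1 x; simp [Matrix.toLpLin_apply]) (by ext1 x; simp [Matrix.toLpLin_apply])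

theorem act_eq_map (φ : GL (Fin n) ℝ) (P : PolytopeO n) :
    P.act φ = P.map (glEquiv φ : E n →ₗ[ℝ] E n) := rfl

theorem invTranspose_apply (φ : GL (Fin n) ℝ) (x : E n) :
    invTranspose φ x = contragredient (glEquiv φ) x := by
  rw [contragredient_apply]
  show Matrix.toEuclideanLin ((φ⁻¹ : GL (Fin n) ℝ) : Matrix (Fin n) (Fin n) ℝ)ᵀ x = _
  rw [← adjoint_toEuclideanLin]
  rfl

theorem exists_mem_SLn {L : E n →ₗ[ℝ] E n} (hL : LinearMap.det L = 1) :
    ∃ φ ∈ SLn n, (glEquiv φ : E n →ₗ[ℝ] E n) = L := by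
  obtain ⟨M, rfl⟩ := Matrix.toEuclideanLin.surjective L
  rw [det_toEuclideanLin] at hL
  exact ⟨_, ⟨⟨M, hL⟩, rfl⟩, rfl⟩

theorem det_of_mem_SLn {φ : GL (Fin n) ℝ} (hφ : φ ∈ SLn n) :
    (φ : Matrix (Fin n) (Fin n) ℝ).det = 1 := by
  obtain ⟨M, rfl⟩ := hφ
  exact M.2

/-- The integral identity says that μ(φP) is the push-forward of μ(P) under φ⁻ᵗ; on atoms,
substituting φᵗx for x removes the inverse. -/
theorem isContravariant_SLn_iff {μ : PolytopeO n → FiniteMeasure (Sph n)}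
    (hμ : ∀ P, IsDiscrete (μ P)) : IsContravariant (SLn n) p μ ↔
      ∀ L : E n →ₗ[ℝ] E n, LinearMap.det L = 1 → ∀ P x, x ≠ 0 →
        atomMass p (μ (P.map L)) x = atomMass p (μ P) (LinearMap.adjoint L x) := by
  have key : ∀ φ ∈ SLn n, ∀ P : PolytopeO n, (∀ f : E n → ℝ, IsContHomogeneous p f →
      ∫ u : Sph n, f u ∂(μ (P.act φ) : Measure (Sph n)) =
      |(φ : Matrix (Fin n) (Fin n) ℝ).det| *
        ∫ u : Sph n, f (invTranspose φ u) ∂(μ P : Measure (Sph n))) ↔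
      ∀ x, x ≠ 0 → atomMass p (μ (P.map (glEquiv φ : E n →ₗ[ℝ] E n))) x =
        atomMass p (μ P) (LinearMap.adjoint (glEquiv φ : E n →ₗ[ℝ] E n) x) := by
    intro φ hφ P
    simp only [det_of_mem_SLn hφ, abs_one, one_mul, invTranspose_apply]
    rw [act_eq_map, ← eq_pushMeasure_iff_integral, eq_pushMeasure_iff_atomMass _ (hμ _) (hμ _)]
    constructor
    · intro h x hx
      rw [← contragredient_symm_apply, ← h _ fun h0 => hx (by simpa using h0),
        LinearEquiv.apply_symm_apply]
    · intro h x hx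
      rw [h _ fun h0 => hx (by simpa using h0), ← contragredient_symm_apply,
        LinearEquiv.symm_apply_apply]
  constructor
  · intro h L hL P
    obtain ⟨φ, hφ, rfl⟩ := exists_mem_SLn hL
    exact (key φ hφ P).1 (h φ hφ P)
  · intro h φ hφ P
    refine (key φ hφ P).2 (h _ ?_ P)
    show LinearMap.det (Matrix.toEuclideanLin (φ : Matrix (Fin n) (Fin n) ℝ)) = 1
    rw [det_toEuclideanLin, det_of_mem_SLn hφ]

theorem isValuation_iff {μ : PolytopeO n → FiniteMeasure (Sph n)} (hμ : ∀ P, IsDiscrete (μ P)) :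
    IsValuation μ ↔ ∀ P Q U I : PolytopeO n, U.carrier = P.carrier ∪ Q.carrier →
      I.carrier = P.carrier ∩ Q.carrier → ∀ x, x ≠ 0 →
        atomMass p (μ U) x + atomMass p (μ I) x = atomMass p (μ P) x + atomMass p (μ Q) x := by
  have hadd : ∀ (ν ν' : FiniteMeasure (Sph n)) (u : Sph n),
      ((ν + ν' : FiniteMeasure (Sph n)) : Measure (Sph n)).real {u} =
      (ν : Measure (Sph n)).real {u} + (ν' : Measure (Sph n)).real {u} := fun ν ν' u => by
    rw [FiniteMeasure.toMeasure_add, measureReal_add_apply]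
  constructor
  · intro h P Q U I hU hI x hx
    simp only [atomMass, dif_pos hx, ← mul_add, ← hadd, h P Q U I hU hI]
  · intro h P Q U I hU hI
    refine ((hμ U).add (hμ I)).ext ((hμ P).add (hμ Q)) fun u => ?_
    have := h P Q U I hU hI u (Sph.ne_zero u)
    simp only [atomMass_sph] at this
    rw [hadd, hadd, this]

theorem isMassFunction_atomMass_iff {μ : PolytopeO n → FiniteMeasure (Sph n)}
    (hμ : ∀ P, IsDiscrete (μ P)) : (IsValuation μ ∧ IsContravariant (SLn n) p μ) ↔
      IsMassFunction p fun P => atomMass p (μ P) := by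
  rw [isValuation_iff (p := p) hμ, isContravariant_SLn_iff hμ]
  refine ⟨fun h => ⟨fun P x => atomMass_nonneg _ x, h.1, fun P x t ht hx => atomMass_smul _ hx ht,
    h.2, fun P => ?_⟩, fun h => ⟨h.valuation, h.map⟩⟩
  obtain ⟨N, hN, hN0⟩ := hμ P
  refine hN.mono fun u hu => ?_
  by_contra huN
  refine hu ?_
  rw [atomMass_sph, measureReal_def, measure_mono_null (Set.singleton_subset_iff.2 huN) hN0,
    ENNReal.toReal_zero]

/-! ### The characterization -/

theorem IsMassFunction.add_comp_neg {w : PolytopeO n → E n → ℝ} (hw : IsMassFunction p w)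
    {a b : ℝ} (ha : 0 ≤ a) (hb : 0 ≤ b) :
    IsMassFunction p fun P x => a * w P x + b * w P (-x) where
  nonneg P x := add_nonneg (mul_nonneg ha (hw.nonneg _ _)) (mul_nonneg hb (hw.nonneg _ _))
  valuation P Q U I hU hI x hx := by
    have h1 := hw.valuation P Q U I hU hI x hx
    have h2 := hw.valuation P Q U I hU hI (-x) (neg_ne_zero.2 hx)
    linear_combination a * h1 + b * h2
  smul P x t ht hx := by
    rw [hw.smul P x t ht hx, ← smul_neg, hw.smul P (-x) t ht (neg_ne_zero.2 hx)]
    ring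
  map L hL P x hx := by
    rw [hw.map L hL P x hx, hw.map L hL P (-x) (neg_ne_zero.2 hx), map_neg]
  countable P := by
    have h1 := hw.countable P
    have h2 : {u : Sph n | w P (-u) ≠ 0}.Countable := by
      have : Function.Injective fun u : Sph n => -u := neg_injective
      refine (h1.preimage_of_injOn this.injOn).mono fun u hu => ?_
      simpa using hu
    refine (h1.union h2).mono fun u hu => ?_
    by_contra h
    simp only [Set.mem_union, Set.mem_ofPred_eq, not_or, not_not] at h
    exact hu (by simp only [h.1, h.2, mul_zero, add_zero])

theorem nnreal_smul_measure_apply (c : ℝ≥0) (ρ : Measure (Sph n)) (A : Set (Sph n)) :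
    (c • ρ) A = (c : ℝ≥0∞) * ρ A := by
  rw [Measure.smul_apply, ENNReal.smul_def, smul_eq_mul]

theorem eq_lpSurfaceArea_iff {ν : FiniteMeasure (Sph n)} (hν : IsDiscrete ν) (c₁ c₂ : ℝ≥0)
    (P : PolytopeO n) :
    (ν : Measure (Sph n)) = c₁ • lpSurfaceArea p P + c₂ • lpSurfaceArea p (-P) ↔
      ∀ x, x ≠ 0 → atomMass p ν x = c₁ * surfaceMass p P x + c₂ * surfaceMass p P (-x) := by
  have hsing : ∀ u : Sph n, (c₁ • lpSurfaceArea p P + c₂ • lpSurfaceArea p (-P)) {u} =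
      ENNReal.ofReal (c₁ * surfaceMass p P u + c₂ * surfaceMass p P (-u)) := by
    intro u
    rw [Measure.add_apply, nnreal_smul_measure_apply, nnreal_smul_measure_apply,
      lpSurfaceArea_singleton, lpSurfaceArea_singleton, surfaceMass_neg,
      ENNReal.ofReal_add (mul_nonneg c₁.coe_nonneg (surfaceMass_nonneg _ _))
        (mul_nonneg c₂.coe_nonneg (surfaceMass_nonneg _ _)), ENNReal.ofReal_mul c₁.coe_nonneg,
      ENNReal.ofReal_mul c₂.coe_nonneg,
      ENNReal.ofReal_coe_nnreal, ENNReal.ofReal_coe_nnreal]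
  constructor
  · intro h
    have key : ∀ u : Sph n, atomMass p ν u =
        c₁ * surfaceMass p P u + c₂ * surfaceMass p P (-u) := by
      intro u
      rw [atomMass_sph, h, measureReal_def, hsing, ENNReal.toReal_ofReal]
      exact add_nonneg (mul_nonneg c₁.coe_nonneg (surfaceMass_nonneg _ _))
        (mul_nonneg c₂.coe_nonneg (surfaceMass_nonneg _ _))
    intro x hx
    have hx0 := norm_pos_iff.2 hx
    rw [← norm_smul_dir x hx, atomMass_smul _ (Sph.ne_zero _) hx0, key, ← smul_neg,
      surfaceMass_smul _ _ _ hx0, surfaceMass_smul _ _ _ hx0]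
    ring
  · intro h
    obtain ⟨N, hN, hN0⟩ := hν
    refine measure_ext_of_singleton hN
      ((finite_facetNormalsStar P).union (finite_facetNormalsStar (-P))).countable hN0 ?_ fun u => ?_
    · rw [Measure.add_apply, nnreal_smul_measure_apply, nnreal_smul_measure_apply,
        measure_mono_null (Set.compl_subset_compl.2 Set.subset_union_left) (lpSurfaceArea_compl P),
        measure_mono_null (Set.compl_subset_compl.2 Set.subset_union_right)
          (lpSurfaceArea_compl (-P)), mul_zero, mul_zero, add_zero]
    · rw [hsing, ← h u (Sph.ne_zero u), atomMass_sph, measureReal_def,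
        ENNReal.ofReal_toReal (measure_ne_top _ _)]

end

end LpSurface

end

theorem mainTheorem5 (n : ℕ) (hn : 3 ≤ n) (p : ℝ) (hp : p ≠ 1)
    (μ : LpSurface.PolytopeO n → FiniteMeasure (LpSurface.Sph n))
    (hμ : ∀ P, LpSurface.IsDiscrete (μ P)) :
    (LpSurface.IsValuation μ ∧ LpSurface.IsContravariant (LpSurface.SLn n) p μ) ↔
      ∃ c₁ c₂ : ℝ≥0, ∀ P : LpSurface.PolytopeO n,
        (μ P : Measure (LpSurface.Sph n)) =
          c₁ • LpSurface.lpSurfaceArea p P + c₂ • LpSurface.lpSurfaceArea p (-P) := by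
  open LpSurface in
  obtain ⟨m, rfl⟩ := Nat.exists_eq_add_of_le' hn
  rw [isMassFunction_atomMass_iff hμ]
  simp only [eq_lpSurfaceArea_iff (hμ _)]
  have hS := isMassFunction_surfaceMass (n := m + 3) (p := p)
  constructor
  · intro hw
    set B : PolytopeO (m + 3) := box (0 : Fin (m + 2) → ℝ) (fun _ => 1) with hB
    have hs : 0 < surfaceMass p B (unitVec 0) := surfaceMass_box_pos
    have hs' : surfaceMass p B (-unitVec 0) = 0 := surfaceMass_box_neg
    have h1 := div_nonneg (hw.nonneg B (unitVec 0)) hs.le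
    have h2 := div_nonneg (hw.nonneg B (-unitVec 0)) hs.le
    -- The constants are the values of w at B in directions e₀ and -e₀ divided by that of
    -- `surfaceMass` at e₀. As `surfaceMass` vanishes at -e₀, each direction sees only one constant.
    refine ⟨⟨_, h1⟩, ⟨_, h2⟩, fun P x hx => ?_⟩
    refine hw.eq_of_box_eq (hS.add_comp_neg h1 h2) hp ?_ ?_ P hx
    · rw [← hB, hs', mul_zero, add_zero, div_mul_cancel₀ _ hs.ne']
    · rw [← hB, neg_neg, hs', mul_zero, zero_add, div_mul_cancel₀ _ hs.ne']
  · rintro ⟨c₁, c₂, h⟩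
    have hT := hS.add_comp_neg c₁.coe_nonneg c₂.coe_nonneg
    -- The two functions are known to agree only for x ≠ 0, so the properties are transferred one by
    -- one.
    refine ⟨fun P x => atomMass_nonneg _ x, fun P Q U I hU hI x hx => ?_,
      fun P x t ht hx => atomMass_smul _ hx ht, fun L hL P x hx => ?_, fun P => ?_⟩
    · simp only [h _ x hx]
      exact hT.valuation P Q U I hU hI x hx
    · have hx' : LinearMap.adjoint L x ≠ 0 := by
        intro h0
        obtain ⟨φ, -, rfl⟩ := exists_mem_SLn hL
        exact hx ((contragredient (glEquiv φ)).symm.map_eq_zero_iff.1 h0)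
      rw [h _ x hx, h _ _ hx']
      exact hT.map L hL P x hx
    · refine (hT.countable P).mono fun u hu => ?_
      rw [Set.mem_ofPred_eq, h P u (Sph.ne_zero u)] at hu
      exact hu
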